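/- Let $d\ge 3$, and let $M=2^b>4$ ($b$ an integer) satisfy $M^2>3^d+1$. Let $(X_t)_{t\ge 0}$ under $P_x$ be the continuous-time simple random walk on $\mathbb Z^d$ with unit jump rate started at $x$, let $g(x,y)=E_x\big[\int_0^\infty 1\{X_s=y\}\,ds\big]$ be its Green function, and let $$c_*=\sup\{g(x,y)\,|y-x|^{d-2}:\ x,y\in\mathbb Z^d\},\qquad \delta=\tfrac12\,(4c_*M^{2d-2})^{-1},$$ with $|\cdot|$ the Euclidean norm. For finite $A\subset\mathbb Z^d$ let $\mathrm{cap}(A)=\sum_{x\in A}P_x[\widetilde H_A=\infty]$, where $\widetilde H_A$ is the first time after the first jump at which $X$ is in $A$. For finite sets $A$, $|A|$ is the number of points. For an integer $N\ge 1$ let $L_0=\lfloor N^{1/(d-1)}\rfloor$ and $L_1=k_NL_0$, where $k_N$ is the integer with $k_NL_0\le N^{2/d}(\log N)^{1/d}<(k_N+1)L_0$. Suppose that $L_1\ge 1$ and let $\ell_N\ge 0$ be the integer with $M^{\ell_N}L_1\le N<M^{\ell_N+1}L_1$. For $0\le\ell\le\ell_N$ let $\mathcal I_\ell$ be the collection of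 boxes $\big(M^{\ell_N-\ell}L_1z+[0,M^{\ell_N-\ell}L_1)^d\big)\cap\mathbb Z^d$, $z\in\mathbb Z^d$. For $B\in\mathcal I_\ell$ the tower above $B$ is the collection of all $B'\in\bigcup_{0\le\ell'\le\ell}\mathcal I_{\ell'}$ with $B'\supseteq B$, and, for $0\le\ell'\le\ell$, $B^{(\ell')}$ is the unique box of $\mathcal I_{\ell'}$ containing $B$. Let $1\le q\le\ell_N$ and $F\subseteq\mathbb Z^d$. A box $B\in\mathcal I_q$ is called rarefied (relative to $F$) if $$\sum_{B\subseteq\widetilde B\subseteq B^{(1)}}\frac{\mathrm{cap}(\widetilde B\cap F)}{|\widetilde B|^{(d-2)/d}}<\delta q,$$ where the sum runs over the boxes $\widetilde B$ in the tower above $B$ that are contained in $B^{(1)}$. **Proposition 2.1.** There is a constant $c_3>0$, depending only on $d$ and $M$ (hence only on $d$, once $M$ is fixed as a function of $d$), such that for all $N$, $q$ and $F$ as above with $$L_1^{d-2}\,g(0,0)>2c_*M^d,$$ and for every box $\Delta\in\mathcal I_0$, $$\sum_{B\in\mathcal I_q\ \text{rarefied},\ B\subseteq\Delta}|B\cap F|\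 \le\ c_3\,|\Delta|\,\Big(\frac{M^2}{3^d+1}\Big)^{-q/2}.$$ -/

import Mathlib

open MeasureTheory ProbabilityTheory
open scoped ENNReal

namespace RarefiedBox

noncomputable section

/-! ### The continuous-time simple random walk on `ℤ^d` -/

/-- The neighbours of the origin in `ℤ^d`. -/
def unitSteps (d : ℕ) : Set (Fin d → ℤ) :=
  {e | ∃ i, e = Pi.single i 1 ∨ e = Pi.single i (-1)}

/-- The law of one step of the walk: uniform on the `2 d` neighbours of the origin. -/
def stepLaw (d : ℕ) : Measure (Fin d → ℤ) := uniformOn (unitSteps d)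

/-- A sample point records the successive steps and the successive holding times. -/
abbrev Sample (d : ℕ) : Type := (ℕ → Fin d → ℤ) × (ℕ → ℝ)

/-- The steps are i.i.d. uniform on the neighbours of the origin, and, independently of them, the
holding times are i.i.d. exponential of parameter `1` (unit jump rate). -/
def walkMeasure (d : ℕ) : Measure (Sample d) :=
  (Measure.infinitePi fun _ : ℕ => stepLaw d).prod (Measure.infinitePi fun _ : ℕ => expMeasure 1)

/-- Time of the `n`-th jump (with value `0` for `n = 0`). -/
def jumpTime {d : ℕ} (ω : Sample d) (n : ℕ) : ℝ := ∑ k ∈ Finset.range n, ω.2 k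

/-- Position of the walk started at `x` after `n` jumps. -/
def skeleton {d : ℕ} (x : Fin d → ℤ) (ω : Sample d) (n : ℕ) : Fin d → ℤ :=
  x + ∑ k ∈ Finset.range n, ω.1 k

/-- Number of jumps up to time `t` (almost surely finite). -/
def jumpCount {d : ℕ} (ω : Sample d) (t : ℝ) : ℕ := sSup {n : ℕ | jumpTime ω n ≤ t}

/-- Position `X_t` at time `t ≥ 0` of the walk started at `x`. -/
def walk {d : ℕ} (x : Fin d → ℤ) (ω : Sample d) (t : ℝ) : Fin d → ℤ :=
  skeleton x ω (jumpCount ω t)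

/-- The Green function `g(x, y) = E_x [∫_0^∞ 1{X_s = y} ds]`. -/
def green {d : ℕ} (x y : Fin d → ℤ) : ℝ :=
  (∫⁻ ω, (∫⁻ s in Set.Ici (0 : ℝ), Set.indicator {t : ℝ | walk x ω t = y} 1 s)
    ∂walkMeasure d).toReal

/-- The hitting time of `A`: the first time after the first jump at which the walk started at `x`
is in `A` (`⊤` if there is none). -/
def hittingTime {d : ℕ} (x : Fin d → ℤ) (A : Set (Fin d → ℤ)) (ω : Sample d) : ℝ≥0∞ :=
  ⨅ (t : ℝ) (_ : jumpTime ω 1 ≤ t ∧ walk x ω t ∈ A), ENNReal.ofReal t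

/-- The capacity of a finite set `A`: the total mass of its equilibrium measure
`e_A(x) = P_x[hitting time of A is infinite]`, `x ∈ A`. -/
def capacity {d : ℕ} (A : Finset (Fin d → ℤ)) : ℝ :=
  ∑ x ∈ A, (walkMeasure d).real {ω | hittingTime x (A : Set (Fin d → ℤ)) ω = ⊤}

/-- The Euclidean norm of a point of `ℤ^d`. -/
def euclNorm {d : ℕ} (x : Fin d → ℤ) : ℝ := √(∑ i, (x i : ℝ) ^ 2)

/-- The constant `c_* = sup {g(x, y) |y - x|^{d-2} ; x, y ∈ ℤ^d}`. -/
def cStar (d : ℕ) : ℝ :=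
  sSup {r : ℝ | ∃ x y : Fin d → ℤ, r = green x y * euclNorm (y - x) ^ (d - 2)}

/-! ### Length scales and the `M`-adic decomposition -/

/-- `L₀ = [N^{1/(d-1)}]`. -/
def scaleL₀ (d N : ℕ) : ℕ := ⌊(N : ℝ) ^ (1 / ((d : ℝ) - 1))⌋₊

/-- `L₁ = k_N L₀`, with `k_N` the integer such that
`k_N L₀ ≤ N^{2/d} (log N)^{1/d} < (k_N + 1) L₀`. -/
def scaleL₁ (d N : ℕ) : ℕ :=
  ⌊(N : ℝ) ^ (2 / (d : ℝ)) * Real.log N ^ (1 / (d : ℝ)) / (scaleL₀ d N : ℝ)⌋₊ * scaleL₀ d N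

/-- The box `x + [0, L)^d` of `ℤ^d`. -/
def box {d : ℕ} (x : Fin d → ℤ) (L : ℕ) : Finset (Fin d → ℤ) :=
  Fintype.piFinset fun i => Finset.Ico (x i) (x i + L)

/-- The collection `I_ℓ` of `M`-adic boxes of depth `ℓ ≤ n`, where `L` is the smallest scale and
`M ^ n * L` the largest one: the boxes of size `R = M ^ (n - ℓ) * L` with base point in `R ℤ^d`. -/
def adicBoxes (d M L n ℓ : ℕ) : Set (Finset (Fin d → ℤ)) :=
  {B | ∃ z : Fin d → ℤ,
    B = box (fun i => ((M ^ (n - ℓ) * L : ℕ) : ℤ) * z i) (M ^ (n - ℓ) * L)}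

/-- The tower above a box `B` of depth `ℓ`: all `M`-adic boxes of depth at most `ℓ` containing `B`. -/
def tower {d : ℕ} (M L n ℓ : ℕ) (B : Finset (Fin d → ℤ)) : Set (Finset (Fin d → ℤ)) :=
  {B' | ∃ ℓ' ≤ ℓ, B' ∈ adicBoxes d M L n ℓ' ∧ B ⊆ B'}

/-- The box `B^{(ℓ')}`: the unique box of depth `ℓ'` that contains `B`
(see `existsUnique_ancestor`). -/
def ancestor {d : ℕ} (M L n ℓ' : ℕ) (B : Finset (Fin d → ℤ)) : Finset (Fin d → ℤ) :=
  Classical.epsilon fun B' => B' ∈ adicBoxes d M L n ℓ' ∧ B ⊆ B'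

/-- The finite set `B ∩ F`. -/
def interSet {d : ℕ} (B : Finset (Fin d → ℤ)) (F : Set (Fin d → ℤ)) : Finset (Fin d → ℤ) :=
  open Classical in B.filter (· ∈ F)

/-- `δ = δ₀ / 2` with `δ₀ = (4 c_* M^{2d-2})⁻¹`. -/
def delta (d M : ℕ) : ℝ := 1 / 2 * (4 * cStar d * (M : ℝ) ^ (2 * d - 2))⁻¹

/-- A box `B` of depth `q` is rarefied (relative to `F`) if the sum of
`cap(B' ∩ F) / |B'|^{(d-2)/d}`, over the boxes `B'` in the tower above `B` that are contained in
`B^{(1)}`, is less than `δ q`. -/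
def IsRarefied {d : ℕ} (M L n q : ℕ) (F : Set (Fin d → ℤ)) (B : Finset (Fin d → ℤ)) : Prop :=
  open Classical in
  ∑ B' ∈ (ancestor M L n 1 B).powerset.filter (· ∈ tower M L n q B),
    capacity (interSet B' F) / (B'.card : ℝ) ^ (((d : ℝ) - 2) / (d : ℝ)) < delta d M * q

/-- The rarefied boxes of depth `q` contained in `Δ`. -/
def rarefiedBoxes {d : ℕ} (M L n q : ℕ) (F : Set (Fin d → ℤ)) (Δ : Finset (Fin d → ℤ)) :
    Finset (Finset (Fin d → ℤ)) :=
  open Classical in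
  Δ.powerset.filter fun B => B ∈ adicBoxes d M L n q ∧ IsRarefied M L n q F B

/-! ### Well-definedness of the objects above -/

theorem isProbabilityMeasure_stepLaw {d : ℕ} (hd : 0 < d) : IsProbabilityMeasure (stepLaw d) := by
  refine isProbabilityMeasure_uniformOn ?_ ⟨Pi.single ⟨0, hd⟩ 1, ⟨0, hd⟩, Or.inl rfl⟩
  have : unitSteps d = (Set.range fun i : Fin d => (Pi.single i 1 : Fin d → ℤ)) ∪
      Set.range fun i : Fin d => (Pi.single i (-1) : Fin d → ℤ) := by
    ext e
    simp only [unitSteps, Set.mem_ofPred_eq, Set.mem_union, Set.mem_range, exists_or, eq_comm]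
  rw [this]
  exact (Set.finite_range _).union (Set.finite_range _)

theorem mem_box {d : ℕ} {x y : Fin d → ℤ} {L : ℕ} :
    y ∈ box x L ↔ ∀ i, x i ≤ y i ∧ y i < x i + L := by
  simp [box]

theorem existsUnique_ancestor {d M L n ℓ ℓ' : ℕ} (hM : 0 < M) (hL : 0 < L) (h : ℓ' ≤ ℓ)
    (hn : ℓ ≤ n) {B : Finset (Fin d → ℤ)} (hB : B ∈ adicBoxes d M L n ℓ) :
    ∃! B', B' ∈ adicBoxes d M L n ℓ' ∧ B ⊆ B' := by
  obtain ⟨z, rfl⟩ := hB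
  have hK : M ^ (n - ℓ') * L = M ^ (ℓ - ℓ') * (M ^ (n - ℓ) * L) := by
    rw [← mul_assoc, ← pow_add]; congr 2; omega
  have hRpos : 0 < M ^ (n - ℓ) * L := by positivity
  have hKpos : 0 < M ^ (ℓ - ℓ') := by positivity
  simp only [adicBoxes, Set.mem_ofPred_eq, hK]
  generalize M ^ (n - ℓ) * L = R at *
  generalize M ^ (ℓ - ℓ') = K at *
  have hR : (0 : ℤ) < R := by exact_mod_cast hRpos
  have hK' : (0 : ℤ) < K := by exact_mod_cast hKpos
  refine ⟨box (fun i => ((K * R : ℕ) : ℤ) * (z i / K)) (K * R), ⟨⟨fun i => z i / K, rfl⟩, ?_⟩, ?_⟩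
  · intro y hy
    rw [mem_box] at hy ⊢
    intro i
    obtain ⟨h1, h2⟩ := hy i
    have e1 := Int.emod_add_mul_ediv (z i) K
    have e2 := Int.emod_nonneg (z i) hK'.ne'
    have e3 := Int.emod_lt_of_pos (z i) hK'
    push_cast
    constructor <;> nlinarith
  · rintro _ ⟨⟨w, rfl⟩, hw⟩
    have hz : (fun i => (R : ℤ) * z i) ∈ box (fun i => (R : ℤ) * z i) R := by
      rw [mem_box]; intro i; exact ⟨le_rfl, by linarith⟩
    have := hw hz
    rw [mem_box] at this
    have hwz : w = fun i => z i / K := by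
      funext i
      obtain ⟨h1, h2⟩ := this i
      push_cast at h1 h2
      have a1 : (K : ℤ) * w i ≤ z i := by
        by_contra hc
        push Not at hc
        nlinarith
      have a2 : z i < K * w i + K := by
        by_contra hc
        push Not at hc
        nlinarith
      refine ((Int.ediv_eq_iff_of_pos hK').2 ?_).symm
      constructor <;> nlinarith
    rw [hwz]

theorem ancestor_spec {d M L n ℓ ℓ' : ℕ} (hM : 0 < M) (hL : 0 < L) (h : ℓ' ≤ ℓ)
    (hn : ℓ ≤ n) {B : Finset (Fin d → ℤ)} (hB : B ∈ adicBoxes d M L n ℓ) :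
    ancestor M L n ℓ' B ∈ adicBoxes d M L n ℓ' ∧ B ⊆ ancestor M L n ℓ' B :=
  Classical.epsilon_spec (existsUnique_ancestor hM hL h hn hB).exists

end

end RarefiedBox

open RarefiedBox

/-!
Write `R` for the side of a box `B` and `w(B) = R² cap(B ∩ F)` for its *weight*, and say that `B` has
small capacity if `cap(B ∩ F) < 2 δ R^(d-2)`. By Markov's inequality a rarefied box of depth `q` is
contained in more than `q / 2` boxes of small capacity of the tower above it
(`lt_two_mul_card_smallDepths`), so it suffices to bound the number of points of `F` in `Δ` that lie
in many boxes of small capacity.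

The heart of the proof is that weights contract (`sum_weight_le`): if `B₁, B₂, …` are disjoint boxes
of small capacity strictly inside a box `B`, of any sizes, then `∑ w(Bⱼ) ≤ (3^d + 1) / M² · w(B)`.
Let `eⱼ` be the equilibrium measure of `Bⱼ ∩ F`. Integrating `∑ Rⱼ² G eⱼ` against the equilibrium
measure of `B ∩ F`, whose potential is `1` on `B ∩ F`, reduces this to the pointwise bound
`∑ Rⱼ² G eⱼ ≤ (3^d + 1) (R / M)²` on `B` (`sum_mul_capacity_le`, `sum_potential_le`). At a given
point each depth contributes at most `3^d` boxes that are not well separated from the point, and for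
these `G eⱼ ≤ 1`. For all others, small capacity means that `Rⱼ² eⱼ` has mass at most `2 δ |Bⱼ|`, so
that `Rⱼ² G eⱼ` is dominated by `2 δ c_*` times the sum over `Bⱼ` of the Newtonian kernel; summed over
the disjoint `Bⱼ` this is of order `δ c_* R²`, which the choice of `δ` makes small compared with what
is left of `(3^d + 1) (R / M)²`.

Iterating along maximal boxes of small capacity, each step using up one of them
(`exists_maximal_boxes`), and bounding the number of points of a set by a multiple of its weight at
the last step (`card_le_capacity`), gives the exponential decay. At the first step the weight of a box
of small capacity is at most `2 δ` times its volume, whence the factor `|Δ|`.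

The potential theory rests on two facts. The smoothed Newtonian potential `(|x|² + a)^(1 - d/2)` is
superharmonic for the discrete walk when `a` is large (`exists_avg_potential_le`); this yields
transience and the bound `g(0, x) ≤ C |x|^(2-d)`, so that `c_*` is a genuine supremum. And the Green
potential of the escape probabilities of a finite set is at most `1`, with equality on the set
(`sum_escapeProb_mul_greenFn_le_one`, `sum_escapeProb_mul_greenFn_eq_one`). Both concern the discrete
skeleton; the continuous-time Green function and capacity are identified with their discrete
counterparts in `green_eq_greenFn` and `capacity_eq`.
-/

namespace RarefiedBox

/-! ### The averaging operator and the discrete heat kernel -/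

/-- The transition operator of the simple random walk: `avg φ x` is the mean of `φ` over the `2 d`
neighbours of `x`. -/
noncomputable def avg {d : ℕ} (φ : (Fin d → ℤ) → ℝ) (x : Fin d → ℤ) : ℝ :=
  (2 * d : ℝ)⁻¹ * ∑ i, (φ (x + Pi.single i 1) + φ (x + Pi.single i (-1)))

/-- The `n`-step transition probabilities from the origin: the iterates of the transition operator
applied to the indicator of the origin. -/
noncomputable def heat (d n : ℕ) : (Fin d → ℤ) → ℝ := avg^[n] (Pi.single 0 1)

/-- The Green function of the discrete skeleton with pole at the origin. -/
noncomputable def greenFn (d : ℕ) (x : Fin d → ℤ) : ℝ := ∑' n, heat d n x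

theorem avg_mono {d : ℕ} {φ ψ : (Fin d → ℤ) → ℝ} (h : φ ≤ ψ) : avg φ ≤ avg ψ := by
  intro x
  unfold avg
  gcongr <;> exact h _

theorem avg_add {d : ℕ} (φ ψ : (Fin d → ℤ) → ℝ) : avg (φ + ψ) = avg φ + avg ψ := by
  funext x
  simp only [avg, Pi.add_apply, Finset.mul_sum, ← Finset.sum_add_distrib]
  exact Finset.sum_congr rfl fun i _ => by ring

theorem avg_smul {d : ℕ} (c : ℝ) (φ : (Fin d → ℤ) → ℝ) : avg (c • φ) = c • avg φ := by
  funext x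
  simp only [avg, Pi.smul_apply, smul_eq_mul, Finset.mul_sum]
  exact Finset.sum_congr rfl fun i _ => by ring

theorem avg_sum {d : ℕ} {ι : Type*} (s : Finset ι) (φ : ι → (Fin d → ℤ) → ℝ) :
    avg (∑ j ∈ s, φ j) = ∑ j ∈ s, avg (φ j) := by
  classical
  induction s using Finset.induction_on with
  | empty => funext x; simp [avg]
  | insert j s hj ih => rw [Finset.sum_insert hj, Finset.sum_insert hj, avg_add, ih]

theorem avg_const {d : ℕ} (hd : d ≠ 0) (c : ℝ) : avg (fun _ : Fin d → ℤ => c) = fun _ => c := by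
  funext x
  have : (d : ℝ) ≠ 0 := by exact_mod_cast hd
  simp only [avg, Finset.sum_const, Finset.card_univ, Fintype.card_fin, nsmul_eq_mul]
  field_simp
  ring

theorem avg_translate {d : ℕ} (φ : (Fin d → ℤ) → ℝ) (y : Fin d → ℤ) :
    avg (fun x => φ (x - y)) = fun x => avg φ (x - y) := by
  funext x
  simp only [avg, add_sub_right_comm]

theorem avg_neg {d : ℕ} (φ : (Fin d → ℤ) → ℝ) (x : Fin d → ℤ) :
    avg (fun x => φ (-x)) x = avg φ (-x) := by
  simp only [avg, neg_add, ← Pi.single_neg, neg_neg]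
  congr 1
  exact Finset.sum_congr rfl fun i _ => add_comm _ _

theorem heat_zero (d : ℕ) : heat d 0 = Pi.single 0 1 := rfl

theorem heat_succ (d n : ℕ) : heat d (n + 1) = avg (heat d n) :=
  Function.iterate_succ_apply' _ _ _

theorem heat_nonneg (d n : ℕ) (x : Fin d → ℤ) : 0 ≤ heat d n x := by
  induction n generalizing x with
  | zero =>
    rw [heat_zero, Pi.single_apply]
    split_ifs <;> norm_num
  | succ n ih =>
    rw [heat_succ, avg]
    exact mul_nonneg (by positivity) (Finset.sum_nonneg fun i _ => add_nonneg (ih _) (ih _))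

theorem heat_neg (d n : ℕ) (x : Fin d → ℤ) : heat d n (-x) = heat d n x := by
  induction n generalizing x with
  | zero => simp [heat_zero, Pi.single_apply]
  | succ n ih =>
    rw [heat_succ, ← avg_neg]
    congr 1
    funext y
    exact ih y

theorem greenFn_neg (d : ℕ) (x : Fin d → ℤ) : greenFn d (-x) = greenFn d x := by
  simp only [greenFn, heat_neg]

theorem greenFn_nonneg (d : ℕ) (x : Fin d → ℤ) : 0 ≤ greenFn d x :=
  tsum_nonneg fun n => heat_nonneg d n x

/-! ### A superharmonic function and the decay of the Green function -/

theorem nonneg_of_second_deriv_nonneg {f f' f'' : ℝ → ℝ} {b : ℝ}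
    (hf : ∀ u ∈ Set.Icc 0 b, HasDerivAt f (f' u) u)
    (hf' : ∀ u ∈ Set.Icc 0 b, HasDerivAt f' (f'' u) u)
    (h0 : f 0 = 0) (h0' : f' 0 = 0) (h : ∀ u ∈ Set.Icc 0 b, 0 ≤ f'' u)
    {u : ℝ} (hu : u ∈ Set.Icc 0 b) : 0 ≤ f u := by
  have key : ∀ {g g' : ℝ → ℝ}, (∀ u ∈ Set.Icc 0 b, HasDerivAt g (g' u) u) → g 0 = 0 →
      (∀ u ∈ Set.Icc 0 b, 0 ≤ g' u) → ∀ u ∈ Set.Icc 0 b, 0 ≤ g u := by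
    intro g g' hg hg0 hg' u hu
    have hm : MonotoneOn g (Set.Icc 0 b) :=
      monotoneOn_of_hasDerivWithinAt_nonneg (convex_Icc 0 b)
        (fun x hx => (hg x hx).continuousAt.continuousWithinAt)
        (fun x hx => (hg x (interior_subset hx)).hasDerivWithinAt)
        (fun x hx => hg' x (interior_subset hx))
    have := hm ⟨le_rfl, hu.1.trans hu.2⟩ hu hu.1
    linarith
  exact key hf h0 (key hf' h0' h) u hu

theorem hasDerivAt_one_add_rpow {t u : ℝ} (hu : -1 < u) :
    HasDerivAt (fun u : ℝ => (1 + u) ^ (-t)) (-t * (1 + u) ^ (-(t + 1))) u := by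
  have := ((hasDerivAt_id' u).const_add 1).rpow_const (p := -t) (Or.inl (by simp; linarith))
  convert this using 1
  simp only [one_mul]
  ring_nf

theorem hasDerivAt_one_sub_rpow {t u : ℝ} (hu : u < 1) :
    HasDerivAt (fun u : ℝ => (1 - u) ^ (-t)) (t * (1 - u) ^ (-(t + 1))) u := by
  have := ((hasDerivAt_id' u).const_sub 1).rpow_const (p := -t) (Or.inl (by simp; linarith))
  convert this using 1
  simp only [one_mul, neg_mul, mul_neg, neg_neg]
  ring_nf

theorem rpow_even_le_quadratic {t : ℝ} (ht : 0 ≤ t) :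
    ∃ K : ℝ, 0 ≤ K ∧ ∀ u ∈ Set.Icc (0 : ℝ) (1 / 2),
      (1 + u) ^ (-t) + (1 - u) ^ (-t) ≤ 2 + K * u ^ 2 := by
  set D : ℝ := 1 + (1 / 2 : ℝ) ^ (-(t + 1 + 1)) with hD
  have hDpos : 0 ≤ D := by positivity
  refine ⟨t * (t + 1) * D, by positivity, fun u hu => ?_⟩
  have := nonneg_of_second_deriv_nonneg (b := 1 / 2)
    (f := fun u => 2 + t * (t + 1) * D * u ^ 2 - ((1 + u) ^ (-t) + (1 - u) ^ (-t)))
    (f' := fun u => t * (t + 1) * D * (2 * u) -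
      (-t * (1 + u) ^ (-(t + 1)) + t * (1 - u) ^ (-(t + 1))))
    (f'' := fun u => t * (t + 1) * D * 2 -
      (-t * (-(t + 1) * (1 + u) ^ (-(t + 1 + 1))) + t * ((t + 1) * (1 - u) ^ (-(t + 1 + 1)))))
    ?_ ?_ ?_ ?_ ?_ hu
  · simpa using this
  · intro u hu
    have h1 := hasDerivAt_one_add_rpow (t := t) (u := u) (by linarith [hu.1])
    have h2 := hasDerivAt_one_sub_rpow (t := t) (u := u) (by linarith [hu.2])
    have h3 : HasDerivAt (fun u : ℝ => u ^ 2) (2 * u) u := by simpa using hasDerivAt_pow 2 u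
    exact ((h3.const_mul _).const_add _).sub (h1.add h2)
  · intro u hu
    have h1 := hasDerivAt_one_add_rpow (t := t + 1) (u := u) (by linarith [hu.1])
    have h2 := hasDerivAt_one_sub_rpow (t := t + 1) (u := u) (by linarith [hu.2])
    have h3 : HasDerivAt (fun u : ℝ => 2 * u) 2 u := by
      simpa using (hasDerivAt_id u).const_mul 2
    exact (h3.const_mul _).sub ((h1.const_mul _).add (h2.const_mul _))
  · norm_num
  · simp
  · intro u hu
    have h1 : (1 + u) ^ (-(t + 1 + 1)) ≤ 1 :=
      Real.rpow_le_one_of_one_le_of_nonpos (by linarith [hu.1]) (by linarith)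
    have h2 : (1 - u) ^ (-(t + 1 + 1)) ≤ (1 / 2 : ℝ) ^ (-(t + 1 + 1)) :=
      Real.rpow_le_rpow_of_nonpos (by norm_num) (by linarith [hu.2]) (by linarith)
    have h3 : (1 + u) ^ (-(t + 1 + 1)) + (1 - u) ^ (-(t + 1 + 1)) ≤ D := by linarith
    have h4 : 0 ≤ t * (t + 1) := by positivity
    nlinarith [mul_le_mul_of_nonneg_left h3 h4, mul_nonneg h4 hDpos]

/-- Second order Taylor expansion of the even part of `(1 + u) ^ (-t)`. -/
theorem rpow_even_le_quartic {t : ℝ} (ht : 0 ≤ t) :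
    ∃ K : ℝ, 0 ≤ K ∧ ∀ u : ℝ, |u| ≤ 1 / 2 →
      (1 + u) ^ (-t) + (1 - u) ^ (-t) ≤ 2 + t * (t + 1) * u ^ 2 + K * u ^ 4 := by
  obtain ⟨D, hD, hDu⟩ := rpow_even_le_quadratic (t := t + 1 + 1) (by linarith)
  have key : ∀ u ∈ Set.Icc (0 : ℝ) (1 / 2),
      (1 + u) ^ (-t) + (1 - u) ^ (-t) ≤ 2 + t * (t + 1) * u ^ 2 + t * (t + 1) * D * u ^ 4 := by
    intro u hu
    have := nonneg_of_second_deriv_nonneg (b := 1 / 2)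
      (f := fun u => 2 + t * (t + 1) * u ^ 2 + t * (t + 1) * D * u ^ 4 -
        ((1 + u) ^ (-t) + (1 - u) ^ (-t)))
      (f' := fun u => t * (t + 1) * (2 * u) + t * (t + 1) * D * (4 * u ^ 3) -
        (-t * (1 + u) ^ (-(t + 1)) + t * (1 - u) ^ (-(t + 1))))
      (f'' := fun u => t * (t + 1) * 2 + t * (t + 1) * D * (4 * (3 * u ^ 2)) -
        (-t * (-(t + 1) * (1 + u) ^ (-(t + 1 + 1))) + t * ((t + 1) * (1 - u) ^ (-(t + 1 + 1)))))
      ?_ ?_ ?_ ?_ ?_ hu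
    · simpa using this
    · intro u hu
      have h1 := hasDerivAt_one_add_rpow (t := t) (u := u) (by linarith [hu.1])
      have h2 := hasDerivAt_one_sub_rpow (t := t) (u := u) (by linarith [hu.2])
      have h3 : HasDerivAt (fun u : ℝ => u ^ 2) (2 * u) u := by simpa using hasDerivAt_pow 2 u
      have h4 : HasDerivAt (fun u : ℝ => u ^ 4) (4 * u ^ 3) u := by simpa using hasDerivAt_pow 4 u
      exact (((h3.const_mul _).const_add _).add (h4.const_mul _)).sub (h1.add h2)
    · intro u hu
      have h1 := hasDerivAt_one_add_rpow (t := t + 1) (u := u) (by linarith [hu.1])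
      have h2 := hasDerivAt_one_sub_rpow (t := t + 1) (u := u) (by linarith [hu.2])
      have h3 : HasDerivAt (fun u : ℝ => 2 * u) 2 u := by
        simpa using (hasDerivAt_id u).const_mul 2
      have h4 : HasDerivAt (fun u : ℝ => 4 * u ^ 3) (4 * (3 * u ^ 2)) u := by
        simpa using (hasDerivAt_pow 3 u).const_mul 4
      exact ((h3.const_mul _).add (h4.const_mul _)).sub ((h1.const_mul _).add (h2.const_mul _))
    · norm_num
    · simp
    · intro u hu
      have h3 := hDu u hu
      have h4 : 0 ≤ t * (t + 1) := by positivity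
      nlinarith [mul_le_mul_of_nonneg_left h3 h4,
        mul_nonneg h4 (mul_nonneg hD (sq_nonneg u))]
  refine ⟨t * (t + 1) * D, by positivity, fun u hu => ?_⟩
  rcases le_total 0 u with h | h
  · exact key u ⟨h, (le_abs_self u).trans hu⟩
  · have := key (-u) ⟨by linarith, (neg_le_abs u).trans hu⟩
    rw [sub_neg_eq_add, ← sub_eq_add_neg] at this
    rw [add_comm]
    rwa [neg_sq, show (-u) ^ 4 = u ^ 4 by ring] at this

/-- The squared Euclidean norm. -/
def sqNorm {d : ℕ} (x : Fin d → ℤ) : ℝ := ∑ i, (x i : ℝ) ^ 2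

theorem sqNorm_nonneg {d : ℕ} (x : Fin d → ℤ) : 0 ≤ sqNorm x :=
  Finset.sum_nonneg fun _ _ => sq_nonneg _

theorem sqNorm_add_single {d : ℕ} (x : Fin d → ℤ) (i : Fin d) (c : ℤ) :
    sqNorm (x + Pi.single i c) = sqNorm x + 2 * c * x i + c ^ 2 := by
  have h : ∀ j, (((x + Pi.single i c : Fin d → ℤ) j : ℤ) : ℝ) ^ 2 =
      (x j : ℝ) ^ 2 + if j = i then (2 * c * x j + c ^ 2 : ℝ) else 0 := by
    intro j
    by_cases hj : j = i
    · subst hj; simp; ring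
    · simp [hj]
  simp only [sqNorm, h, Finset.sum_add_distrib, Finset.sum_ite_eq', Finset.mem_univ, if_true]
  ring

/-- With `a > 0`, a discrete substitute for the Newtonian potential, smoothed at the origin. -/
noncomputable def potential (d : ℕ) (a : ℝ) (x : Fin d → ℤ) : ℝ :=
  (sqNorm x + a) ^ (-((d : ℝ) / 2 - 1))

/-- For large `a` the smoothed potential `(|x|² + a) ^ (1 - d/2)` is superharmonic for the walk:
its continuous Laplacian is of order `- a |x| ^ (-d - 2)`, whereas the discretization error is of
order `|x| ^ (-d - 2)` with a constant independent of `a`. -/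
theorem exists_avg_potential_le {d : ℕ} (hd : 3 ≤ d) :
    ∃ a : ℝ, 0 < a ∧ avg (potential d a) ≤ potential d a := by
  have hd' : (3 : ℝ) ≤ d := by exact_mod_cast hd
  set s : ℝ := (d : ℝ) / 2 - 1 with hs
  have hs0 : 0 < s := by linarith
  obtain ⟨K, hK, hKu⟩ := rpow_even_le_quartic hs0.le
  refine ⟨3 + 8 * K / (d * s), by positivity, fun x => ?_⟩
  set a : ℝ := 3 + 8 * K / (d * s) with ha
  have ha3 : 3 ≤ a := by rw [ha]; linarith [show 0 ≤ 8 * K / (d * s) by positivity]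
  have hx0 := sqNorm_nonneg x
  set R : ℝ := sqNorm x + a + 1 with hR
  have hR0 : 0 < R := by linarith
  have hxi : ∀ i, (x i : ℝ) ^ 2 ≤ sqNorm x := fun i =>
    Finset.single_le_sum (f := fun i => (x i : ℝ) ^ 2) (fun _ _ => sq_nonneg _)
      (Finset.mem_univ i)
  have hu : ∀ i, |2 * (x i : ℝ) / R| ≤ 1 / 2 := by
    intro i
    rw [abs_div, abs_of_pos hR0, div_le_iff₀ hR0, abs_le]
    constructor <;> nlinarith [hxi i, sq_nonneg ((x i : ℝ) - 2), sq_nonneg ((x i : ℝ) + 2)]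
  have hterm : ∀ i, potential d a (x + Pi.single i 1) + potential d a (x + Pi.single i (-1)) ≤
      R ^ (-s) * (2 + s * (s + 1) * (2 * x i / R) ^ 2 + K * (2 * x i / R) ^ 4) := by
    intro i
    have h1 := abs_le.1 (hu i)
    have e1 : sqNorm (x + Pi.single i 1) + a = R * (1 + 2 * x i / R) := by
      rw [sqNorm_add_single]; field_simp; rw [hR]; push_cast; ring
    have e2 : sqNorm (x + Pi.single i (-1)) + a = R * (1 - 2 * x i / R) := by
      rw [sqNorm_add_single]; field_simp; rw [hR]; push_cast; ring
    rw [potential, potential, e1, e2, Real.mul_rpow hR0.le (by linarith [h1.1]),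
      Real.mul_rpow hR0.le (by linarith [h1.2]), ← mul_add]
    exact mul_le_mul_of_nonneg_left (hKu _ (hu i)) (by positivity)
  have hsum2 : ∑ i, (2 * (x i : ℝ) / R) ^ 2 = 4 * (R - 1 - a) / R ^ 2 := by
    have : R - 1 - a = sqNorm x := by rw [hR]; ring
    rw [this, sqNorm, Finset.mul_sum, Finset.sum_div]
    exact Finset.sum_congr rfl fun i _ => by rw [div_pow, mul_pow]; norm_num
  have hsum4 : ∑ i, (2 * (x i : ℝ) / R) ^ 4 ≤ 16 / R ^ 2 := by
    have h1 : ∀ i, (2 * (x i : ℝ) / R) ^ 4 ≤ (2 * (x i : ℝ) / R) ^ 2 * (4 / R) := by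
      intro i
      have : (2 * (x i : ℝ) / R) ^ 2 ≤ 4 / R := by
        rw [div_pow, div_le_div_iff₀ (by positivity) hR0]
        nlinarith [hxi i]
      calc (2 * (x i : ℝ) / R) ^ 4 = (2 * (x i : ℝ) / R) ^ 2 * (2 * (x i : ℝ) / R) ^ 2 := by ring
        _ ≤ _ := mul_le_mul_of_nonneg_left this (sq_nonneg _)
    calc _ ≤ ∑ i, (2 * (x i : ℝ) / R) ^ 2 * (4 / R) := Finset.sum_le_sum fun i _ => h1 i
      _ = 4 * (R - 1 - a) / R ^ 2 * (4 / R) := by rw [← Finset.sum_mul, hsum2]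
      _ ≤ 4 * R / R ^ 2 * (4 / R) := by gcongr; linarith
      _ = _ := by field_simp; norm_num
  have hbern : 1 + s / R ≤ (1 - 1 / R) ^ (-s) := by
    have hpos : 0 < 1 - 1 / R := by
      rw [sub_pos, div_lt_one hR0]; linarith
    rw [Real.rpow_def_of_pos hpos]
    have h1 := Real.log_le_sub_one_of_pos hpos
    have h2 := Real.add_one_le_exp (Real.log (1 - 1 / R) * -s)
    have h3 : s / R = s * (1 / R) := by ring
    nlinarith
  have hRs : 0 ≤ R ^ (-s) := by positivity
  have hdK : d * s * a = 3 * d * s + 8 * K := by rw [ha]; field_simp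
  calc avg (potential d a) x
      ≤ (2 * d : ℝ)⁻¹ * ∑ i,
          (R ^ (-s) * (2 + s * (s + 1) * (2 * x i / R) ^ 2 + K * (2 * x i / R) ^ 4)) := by
        unfold avg
        gcongr with i
        exact hterm i
    _ = R ^ (-s) * ((2 * d : ℝ)⁻¹ * (2 * d + s * (s + 1) * ∑ i, (2 * (x i : ℝ) / R) ^ 2 +
          K * ∑ i, (2 * (x i : ℝ) / R) ^ 4)) := by
        rw [← Finset.mul_sum]
        simp only [Finset.sum_add_distrib, ← Finset.mul_sum, Finset.sum_const, Finset.card_univ,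
          Fintype.card_fin, nsmul_eq_mul]
        ring
    _ ≤ R ^ (-s) * ((2 * d : ℝ)⁻¹ * (2 * d + s * (s + 1) * (4 * (R - 1 - a) / R ^ 2) +
          K * (16 / R ^ 2))) := by
        rw [hsum2]
        gcongr
    _ ≤ R ^ (-s) * (1 + s / R) := by
        refine mul_le_mul_of_nonneg_left ?_ hRs
        have e : (2 * d : ℝ)⁻¹ * (2 * d + s * (s + 1) * (4 * (R - 1 - a) / R ^ 2) +
            K * (16 / R ^ 2)) = 1 + s / R + (8 * K - d * s * (1 + a)) / (d * R ^ 2) := by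
          rw [show s + 1 = d / 2 by rw [hs]; ring]
          field_simp
          ring
        rw [e]
        have : (8 * K - d * s * (1 + a)) / (d * R ^ 2) ≤ 0 :=
          div_nonpos_of_nonpos_of_nonneg (by nlinarith [mul_pos (by linarith : (0:ℝ) < d) hs0])
            (by positivity)
        linarith
    _ ≤ R ^ (-s) * (1 - 1 / R) ^ (-s) := mul_le_mul_of_nonneg_left hbern hRs
    _ = potential d a x := by
        rw [← Real.mul_rpow hR0.le (by rw [sub_nonneg, div_le_one hR0]; linarith), potential]
        congr 1
        field_simp
        rw [hR]; ring

/-- The heat kernel is summable in time, with the decay of the Newtonian potential: the partial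
sums of the heat kernel are dominated by every nonnegative `f` such that `f - avg f` dominates the
indicator of the origin. -/
theorem exists_sum_heat_le {d : ℕ} (hd : 3 ≤ d) :
    ∃ a C : ℝ, 0 < a ∧ 0 < C ∧ ∀ n x, ∑ k ∈ Finset.range n, heat d k x ≤ C * potential d a x := by
  obtain ⟨a, ha, hsup⟩ := exists_avg_potential_le hd
  have hd' : (3 : ℝ) ≤ d := by exact_mod_cast hd
  set ε : ℝ := potential d a 0 - avg (potential d a) 0 with hε
  have hε0 : 0 < ε := by
    have h1 : ∀ (i : Fin d) (c : ℤ), c ^ 2 = 1 →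
        potential d a (0 + Pi.single i c) = (1 + a) ^ (-((d : ℝ) / 2 - 1)) := by
      intro i c hc
      have : (c : ℝ) ^ 2 = 1 := by exact_mod_cast hc
      rw [potential, sqNorm_add_single]
      simp [sqNorm, this]
    have h2 : avg (potential d a) 0 = (1 + a) ^ (-((d : ℝ) / 2 - 1)) := by
      simp only [avg, h1 _ 1 (by norm_num), h1 _ (-1) (by norm_num), Finset.sum_const,
        Finset.card_univ, Fintype.card_fin, nsmul_eq_mul]
      field_simp
      ring
    have h3 : potential d a (0 : Fin d → ℤ) = a ^ (-((d : ℝ) / 2 - 1)) := by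
      simp [potential, sqNorm]
    rw [hε, h2, h3, sub_pos]
    exact Real.rpow_lt_rpow_of_neg ha (by linarith) (by linarith)
  -- the partial sums satisfy `s (n + 1) = δ₀ + avg (s n)`, and `ε δ₀ ≤ f - avg f`
  have key : ∀ n, ε • ∑ k ∈ Finset.range n, heat d k ≤ potential d a := by
    intro n
    induction n with
    | zero =>
      intro x
      simp only [Finset.range_zero, Finset.sum_empty, smul_zero, Pi.zero_apply]
      exact Real.rpow_nonneg (add_nonneg (sqNorm_nonneg x) ha.le) _
    | succ n ih =>
      have h1 := avg_mono ih
      rw [avg_smul, avg_sum] at h1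
      intro x
      have h2 := h1 x
      rw [Finset.sum_range_succ']
      simp only [heat_succ, heat_zero, Pi.smul_apply, Pi.add_apply, smul_eq_mul, Pi.single_apply]
        at h2 ⊢
      split_ifs with hx
      · subst hx
        rw [mul_add]
        linarith
      · linarith [hsup x]
  refine ⟨a, ε⁻¹, ha, by positivity, fun n x => ?_⟩
  have := key n x
  simp only [Pi.smul_apply, smul_eq_mul, Finset.sum_apply] at this
  rwa [inv_mul_eq_div, le_div_iff₀ hε0, mul_comm]

theorem summable_heat {d : ℕ} (hd : 3 ≤ d) (x : Fin d → ℤ) : Summable fun n => heat d n x := by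
  obtain ⟨a, C, -, -, h⟩ := exists_sum_heat_le hd
  exact summable_of_sum_range_le (fun n => heat_nonneg d n x) fun n => h n x

theorem one_le_greenFn_zero {d : ℕ} (hd : 3 ≤ d) : 1 ≤ greenFn d 0 := by
  have := (summable_heat hd 0).le_tsum 0 fun n _ => heat_nonneg d n 0
  simpa [heat_zero, greenFn] using this

/-- Decay of the Green function, `g(0, x) ≤ C |x| ^ (2 - d)`: this is what makes the supremum
defining `cStar` finite. -/
theorem exists_greenFn_mul_le {d : ℕ} (hd : 3 ≤ d) :
    ∃ C : ℝ, ∀ x, greenFn d x * euclNorm x ^ (d - 2) ≤ C := by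
  obtain ⟨a, C, ha, hC, h⟩ := exists_sum_heat_le hd
  refine ⟨C, fun x => ?_⟩
  have h1 : greenFn d x ≤ C * potential d a x :=
    Real.tsum_le_of_sum_range_le (fun n => heat_nonneg d n x) fun n => h n x
  have h2 : potential d a x * euclNorm x ^ (d - 2) ≤ 1 := by
    have hq := sqNorm_nonneg x
    have e : euclNorm x ^ (d - 2) = (sqNorm x) ^ ((d : ℝ) / 2 - 1) := by
      rw [euclNorm, ← sqNorm, Real.sqrt_eq_rpow, ← Real.rpow_natCast, ← Real.rpow_mul hq]
      congr 1
      rw [Nat.cast_sub (by omega)]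
      push_cast
      ring
    have hd' : (3 : ℝ) ≤ d := by exact_mod_cast hd
    rw [e, potential, Real.rpow_neg (by linarith), inv_mul_eq_div]
    refine div_le_one_of_le₀ (Real.rpow_le_rpow hq (by linarith) (by linarith)) (by positivity)
  have h3 : 0 ≤ euclNorm x ^ (d - 2) := pow_nonneg (Real.sqrt_nonneg _) _
  calc _ ≤ C * potential d a x * euclNorm x ^ (d - 2) := mul_le_mul_of_nonneg_right h1 h3
    _ = C * (potential d a x * euclNorm x ^ (d - 2)) := by ring
    _ ≤ C * 1 := mul_le_mul_of_nonneg_left h2 hC.le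
    _ = C := mul_one C

/-! ### Markov property at the first jump -/

/-- Prepend a term to a sequence. -/
def cons {E : Type*} (e : E) (ω : ℕ → E) : ℕ → E
  | 0 => e
  | n + 1 => ω n

theorem measurable_cons {E : Type*} [MeasurableSpace E] :
    Measurable fun p : E × (ℕ → E) => cons p.1 p.2 := by
  refine measurable_pi_lambda _ fun n => ?_
  cases n with
  | zero => exact measurable_fst
  | succ n => exact (measurable_pi_apply n).comp measurable_snd

/-- The first term of an i.i.d. sequence is independent of the shifted sequence, which has the same
law as the sequence itself. -/
theorem map_cons_prod_infinitePi {E : Type*} [MeasurableSpace E] (ν : Measure E)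
    [IsProbabilityMeasure ν] :
    (ν.prod (Measure.infinitePi fun _ : ℕ => ν)).map (fun p => cons p.1 p.2) =
      Measure.infinitePi fun _ : ℕ => ν := by
  classical
  refine Measure.eq_infinitePi _ fun s t ht => ?_
  obtain ⟨n, hn⟩ := s.exists_nat_subset_range
  set u : ℕ → Set E := fun i => if i ∈ s then t i else Set.univ with hu
  have hum : ∀ i, MeasurableSet (u i) := fun i => by
    simp only [hu]; split_ifs; exacts [ht i, .univ]
  have hpi : Set.pi (s : Set ℕ) t = {ω | ∀ i, ω i ∈ u i} := by
    ext ω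
    simp only [Set.mem_pi, hu, Set.mem_ofPred_eq]
    refine forall_congr' fun i => ?_
    by_cases hi : i ∈ s <;> simp [hi]
  have hpre : (fun p : E × (ℕ → E) => cons p.1 p.2) ⁻¹' Set.pi (s : Set ℕ) t =
      u 0 ×ˢ Set.pi (Finset.range n : Set ℕ) fun i => u (i + 1) := by
    rw [hpi]
    ext ⟨e, ω⟩
    simp only [Set.mem_preimage, Set.mem_ofPred_eq, Set.mem_prod, Set.mem_pi, Finset.coe_range,
      Set.mem_Iio]
    constructor
    · exact fun h => ⟨h 0, fun i _ => h (i + 1)⟩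
    · rintro ⟨h0, h⟩ i
      cases i with
      | zero => exact h0
      | succ i =>
        by_cases hi : i < n
        · exact h i hi
        · have : i + 1 ∉ s := fun hs => by have := Finset.mem_range.1 (hn hs); omega
          simp [hu, this]
  rw [Measure.map_apply measurable_cons (.pi s.countable_toSet fun i _ => ht i), hpre,
    Measure.prod_prod, Measure.infinitePi_pi _ fun i _ => hum (i + 1), mul_comm,
    ← Finset.prod_range_succ' (fun i => ν (u i))]
  have hs : s ⊆ Finset.range (n + 1) := hn.trans (Finset.range_mono (Nat.le_succ n))
  rw [← Finset.prod_subset hs fun i _ hi => by simp [hu, hi]]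
  exact Finset.prod_congr rfl fun i hi => by simp [hu, hi]

/-- The set of unit steps as a finset. -/
def unitStepFinset (d : ℕ) : Finset (Fin d → ℤ) :=
  (Finset.univ.image fun i : Fin d => (Pi.single i 1 : Fin d → ℤ)) ∪
    Finset.univ.image fun i : Fin d => (Pi.single i (-1) : Fin d → ℤ)

theorem coe_unitStepFinset (d : ℕ) : (unitStepFinset d : Set (Fin d → ℤ)) = unitSteps d := by
  ext e
  simp only [unitStepFinset, unitSteps, Finset.coe_union, Finset.coe_image, Finset.coe_univ,
    Set.image_univ, Set.mem_union, Set.mem_range, Set.mem_ofPred_eq, exists_or, eq_comm]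

theorem sum_unitStepFinset {d : ℕ} {β : Type*} [AddCommMonoid β] (f : (Fin d → ℤ) → β) :
    ∑ e ∈ unitStepFinset d, f e = ∑ i, (f (Pi.single i 1) + f (Pi.single i (-1))) := by
  have hinj : ∀ c : ℤ, c ≠ 0 → Function.Injective fun i : Fin d => (Pi.single i c : Fin d → ℤ) := by
    intro c hc i j hij
    by_contra hne
    have := congrFun hij i
    simp [hne, hc] at this
  rw [unitStepFinset, Finset.sum_union, Finset.sum_image ((hinj 1 (by norm_num)).injOn),
    Finset.sum_image ((hinj (-1) (by norm_num)).injOn), Finset.sum_add_distrib]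
  rw [Finset.disjoint_left]
  intro e he he'
  simp only [Finset.mem_image, Finset.mem_univ, true_and] at he he'
  obtain ⟨i, rfl⟩ := he
  obtain ⟨j, hj⟩ := he'
  have := congrFun hj i
  simp only [Pi.single_apply, if_true] at this
  split_ifs at this
  all_goals omega

theorem card_unitStepFinset (d : ℕ) : (unitStepFinset d).card = 2 * d := by
  rw [Finset.card_eq_sum_ones, sum_unitStepFinset]
  simp [mul_comm]

theorem lintegral_stepLaw {d : ℕ} (f : (Fin d → ℤ) → ℝ≥0∞) :
    ∫⁻ e, f e ∂stepLaw d = (2 * d : ℝ≥0∞)⁻¹ * ∑ e ∈ unitStepFinset d, f e := by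
  rw [stepLaw, uniformOn, ProbabilityTheory.cond, ← coe_unitStepFinset, lintegral_smul_measure,
    Measure.count_apply_finset, card_unitStepFinset, lintegral_finset]
  simp only [smul_eq_mul, Nat.cast_mul, Nat.cast_ofNat]
  congr 1
  refine Finset.sum_congr rfl fun e _ => ?_
  simp

/-- The law of the sequence of steps. -/
noncomputable def stepsMeasure (d : ℕ) : Measure (ℕ → Fin d → ℤ) :=
  Measure.infinitePi fun _ : ℕ => stepLaw d

theorem isProbabilityMeasure_stepsMeasure {d : ℕ} (hd : 0 < d) :
    IsProbabilityMeasure (stepsMeasure d) := by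
  have := isProbabilityMeasure_stepLaw hd
  unfold stepsMeasure
  infer_instance

/-- Decomposition of the probability of an event according to the first step. -/
theorem stepsMeasure_real_eq_avg {d : ℕ} (hd : 0 < d) {T : Set (ℕ → Fin d → ℤ)}
    (hT : MeasurableSet T) :
    (stepsMeasure d).real T = avg (fun e => (stepsMeasure d).real {ω | cons e ω ∈ T}) 0 := by
  have := isProbabilityMeasure_stepLaw hd
  have := isProbabilityMeasure_stepsMeasure hd
  have h : stepsMeasure d T =
      (2 * d : ℝ≥0∞)⁻¹ * ∑ e ∈ unitStepFinset d, stepsMeasure d {ω | cons e ω ∈ T} := by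
    rw [← lintegral_stepLaw]
    conv_lhs => rw [stepsMeasure, ← map_cons_prod_infinitePi]
    rw [Measure.map_apply measurable_cons hT, Measure.prod_apply (measurable_cons hT)]
    rfl
  rw [Measure.real, h, ENNReal.toReal_mul, ENNReal.toReal_sum fun e _ => measure_ne_top _ _,
    sum_unitStepFinset]
  simp [avg, Measure.real]

theorem measurable_partialSum {d : ℕ} (n : ℕ) :
    Measurable fun ω : ℕ → Fin d → ℤ => ∑ k ∈ Finset.range n, ω k :=
  Finset.measurable_sum _ fun k _ => measurable_pi_apply k

theorem measurableSet_partialSum_mem {d : ℕ} (n : ℕ) (x : Fin d → ℤ) (S : Set (Fin d → ℤ)) :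
    MeasurableSet {ω : ℕ → Fin d → ℤ | x + ∑ k ∈ Finset.range n, ω k ∈ S} :=
  ((measurable_partialSum n).const_add x) (Set.to_countable S).measurableSet

theorem sum_range_succ_cons {E : Type*} [AddCommMonoid E] (e : E) (ω : ℕ → E) (n : ℕ) :
    ∑ k ∈ Finset.range (n + 1), cons e ω k = e + ∑ k ∈ Finset.range n, ω k := by
  rw [Finset.sum_range_succ', add_comm]
  rfl

/-- The iterates of `avg` are the transition probabilities of the walk. -/
theorem stepsMeasure_real_partialSum_eq {d : ℕ} (hd : 0 < d) (n : ℕ) (x y : Fin d → ℤ) :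
    (stepsMeasure d).real {ω | x + ∑ k ∈ Finset.range n, ω k = y} = heat d n (x - y) := by
  have := isProbabilityMeasure_stepsMeasure hd
  induction n generalizing x with
  | zero =>
    by_cases h : x = y
    · simp [h, heat_zero]
    · simp [h, heat_zero, sub_eq_zero]
  | succ n ih =>
    have hm : MeasurableSet {ω : ℕ → Fin d → ℤ | x + ∑ k ∈ Finset.range (n + 1), ω k = y} :=
      measurableSet_partialSum_mem (n + 1) x {y}
    rw [stepsMeasure_real_eq_avg hd hm]
    simp only [sum_range_succ_cons, Set.mem_ofPred_eq]
    rw [heat_succ, ← congrFun (avg_translate (heat d n) y) x]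
    simp only [avg, zero_add, ← add_assoc, ih]

/-! ### Escape probabilities and the last-exit identity -/

/-- The probability that the discrete walk started at `x` never visits `A`. -/
noncomputable def avoidProb {d : ℕ} (A : Finset (Fin d → ℤ)) (x : Fin d → ℤ) : ℝ :=
  (stepsMeasure d).real {ω | ∀ n, x + ∑ k ∈ Finset.range n, ω k ∉ A}

/-- The probability that the discrete walk started at `x` does not visit `A` at a positive time. -/
noncomputable def escapeProb {d : ℕ} (A : Finset (Fin d → ℤ)) (x : Fin d → ℤ) : ℝ :=
  (stepsMeasure d).real {ω | ∀ n, x + ∑ k ∈ Finset.range (n + 1), ω k ∉ A}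

theorem escapeProb_nonneg {d : ℕ} (A : Finset (Fin d → ℤ)) (x : Fin d → ℤ) :
    0 ≤ escapeProb A x := measureReal_nonneg

theorem measurableSet_escape {d : ℕ} (A : Finset (Fin d → ℤ)) (x : Fin d → ℤ) :
    MeasurableSet {ω : ℕ → Fin d → ℤ | ∀ n, x + ∑ k ∈ Finset.range (n + 1), ω k ∉ A} := by
  have h : ∀ n, MeasurableSet {ω : ℕ → Fin d → ℤ | x + ∑ k ∈ Finset.range (n + 1), ω k ∉ A} :=
    fun n => measurableSet_partialSum_mem (n + 1) x (A : Set (Fin d → ℤ))ᶜ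
  exact MeasurableSet.iInter h |>.congr (by ext; simp)

theorem escapeProb_eq_avg {d : ℕ} (hd : 0 < d) (A : Finset (Fin d → ℤ)) (x : Fin d → ℤ) :
    escapeProb A x = avg (avoidProb A) x := by
  rw [escapeProb, stepsMeasure_real_eq_avg hd (measurableSet_escape A x)]
  simp only [avg, zero_add, Set.mem_ofPred_eq, sum_range_succ_cons, ← add_assoc, avoidProb]

theorem avoidProb_of_mem {d : ℕ} {A : Finset (Fin d → ℤ)} {x : Fin d → ℤ} (hx : x ∈ A) :
    avoidProb A x = 0 := by
  have : {ω : ℕ → Fin d → ℤ | ∀ n, x + ∑ k ∈ Finset.range n, ω k ∉ A} = ∅ := by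
    refine Set.eq_empty_of_forall_notMem fun ω h => ?_
    have := h 0
    simp [hx] at this
  rw [avoidProb, this, measureReal_empty]

theorem avoidProb_of_notMem {d : ℕ} {A : Finset (Fin d → ℤ)} {x : Fin d → ℤ} (hx : x ∉ A) :
    avoidProb A x = escapeProb A x := by
  rw [avoidProb, escapeProb]
  congr 1
  ext ω
  refine ⟨fun h n => h (n + 1), fun h n => ?_⟩
  cases n with
  | zero => simpa using hx
  | succ n => exact h n

/-- The hitting probability is at most the expected number of visits. -/
theorem one_sub_avoidProb_le {d : ℕ} (hd : 3 ≤ d) (A : Finset (Fin d → ℤ)) (x : Fin d → ℤ) :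
    1 - avoidProb A x ≤ ∑ y ∈ A, greenFn d (x - y) := by
  have hd0 : 0 < d := by omega
  have := isProbabilityMeasure_stepsMeasure hd0
  have hm : ∀ n, MeasurableSet {ω : ℕ → Fin d → ℤ | x + ∑ k ∈ Finset.range n, ω k ∉ A} :=
    fun n => measurableSet_partialSum_mem n x (A : Set (Fin d → ℤ))ᶜ
  have hm' : MeasurableSet {ω : ℕ → Fin d → ℤ | ∀ n, x + ∑ k ∈ Finset.range n, ω k ∉ A} :=
    MeasurableSet.iInter hm |>.congr (by ext; simp)
  have hsub : {ω : ℕ → Fin d → ℤ | ∀ n, x + ∑ k ∈ Finset.range n, ω k ∉ A}ᶜ ⊆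
      ⋃ n, ⋃ y ∈ A, {ω | x + ∑ k ∈ Finset.range n, ω k = y} := by
    intro ω hω
    simp only [Set.mem_compl_iff, Set.mem_ofPred_eq, not_forall, not_not] at hω
    simpa using hω
  have hsum : Summable fun n => ∑ y ∈ A, heat d n (x - y) :=
    summable_sum fun y _ => summable_heat hd (x - y)
  have hle : stepsMeasure d {ω : ℕ → Fin d → ℤ | ∀ n, x + ∑ k ∈ Finset.range n, ω k ∉ A}ᶜ ≤
      ENNReal.ofReal (∑' n, ∑ y ∈ A, heat d n (x - y)) := by
    refine (measure_mono hsub).trans ((measure_iUnion_le _).trans ?_)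
    rw [ENNReal.ofReal_tsum_of_nonneg
      (fun n => Finset.sum_nonneg fun y _ => heat_nonneg d n _) hsum]
    refine ENNReal.tsum_le_tsum fun n => (measure_biUnion_finset_le _ _).trans ?_
    rw [ENNReal.ofReal_sum_of_nonneg fun y _ => heat_nonneg d n _]
    refine Finset.sum_le_sum fun y _ => ?_
    rw [← stepsMeasure_real_partialSum_eq hd0, ofReal_measureReal]
  rw [avoidProb, ← probReal_compl_eq_one_sub hm', Measure.real]
  refine (ENNReal.toReal_le_of_le_ofReal (tsum_nonneg fun n =>
    Finset.sum_nonneg fun y _ => heat_nonneg d n _) hle).trans (le_of_eq ?_)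
  exact Summable.tsum_finsetSum fun y _ => summable_heat hd (x - y)

/-- The hitting probability is the Green potential of the escape probabilities on `A`, up to the
probability of hitting `A` after a time that tends to infinity. -/
theorem sum_heat_mul_escapeProb {d : ℕ} (hd : 0 < d) (A : Finset (Fin d → ℤ)) (n : ℕ)
    (x : Fin d → ℤ) :
    ∑ k ∈ Finset.range n, ∑ y ∈ A, escapeProb A y * heat d k (x - y) =
      (1 - avoidProb A x) - avg^[n] (fun z => 1 - avoidProb A z) x := by
  -- the hitting probability is harmonic off `A`, with Laplacian `escapeProb A` on `A`
  have hstep : (fun z => 1 - avoidProb A z) = avg (fun z => 1 - avoidProb A z) +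
      fun z => ∑ y ∈ A, escapeProb A y * heat d 0 (z - y) := by
    have h1 : avg (fun z => 1 - avoidProb A z) = fun z => 1 - escapeProb A z := by
      have : (fun z => 1 - avoidProb A z) = (fun _ => 1) + (-1 : ℝ) • avoidProb A := by
        funext z; simp; ring
      rw [this, avg_add, avg_smul, avg_const hd.ne']
      funext z
      simp [escapeProb_eq_avg hd]; ring
    rw [h1]
    funext z
    have h2 : ∀ y, escapeProb A y * heat d 0 (z - y) = if z = y then escapeProb A y else 0 := by
      intro y
      simp [heat_zero, Pi.single_apply, sub_eq_zero]
    simp only [Pi.add_apply, h2, Finset.sum_ite_eq]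
    split_ifs with hz
    · simp [avoidProb_of_mem hz]
    · simp [avoidProb_of_notMem hz]
  have hheat : ∀ k, avg^[k] (fun z => ∑ y ∈ A, escapeProb A y * heat d 0 (z - y)) =
      fun z => ∑ y ∈ A, escapeProb A y * heat d k (z - y) := by
    intro k
    induction k with
    | zero => rfl
    | succ k ih =>
      rw [Function.iterate_succ_apply', ih]
      have : (fun z => ∑ y ∈ A, escapeProb A y * heat d k (z - y)) =
          ∑ y ∈ A, escapeProb A y • fun z => heat d k (z - y) := by
        funext z; simp
      rw [this, avg_sum]
      funext z
      simp only [avg_smul, avg_translate, Finset.sum_apply, Pi.smul_apply, smul_eq_mul, heat_succ]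
  have hadd : ∀ (k : ℕ) (φ ψ : (Fin d → ℤ) → ℝ), avg^[k] (φ + ψ) = avg^[k] φ + avg^[k] ψ := by
    intro k
    induction k with
    | zero => exact fun _ _ => rfl
    | succ k ih => intro φ ψ; rw [Function.iterate_succ_apply, avg_add, ih]; rfl
  induction n with
  | zero => simp
  | succ n ih =>
    have h := congrFun (congrArg (avg^[n]) hstep) x
    rw [hadd, hheat, ← Function.iterate_succ_apply] at h
    rw [Finset.sum_range_succ, ih]
    simp only [Pi.add_apply] at h
    linarith

theorem sum_escapeProb_mul_greenFn_le_one {d : ℕ} (hd : 3 ≤ d) (A : Finset (Fin d → ℤ))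
    (x : Fin d → ℤ) : ∑ y ∈ A, escapeProb A y * greenFn d (x - y) ≤ 1 := by
  have hd0 : 0 < d := by omega
  have := isProbabilityMeasure_stepsMeasure hd0
  have h0 : ∀ (n : ℕ) z, 0 ≤ avg^[n] (fun z => 1 - avoidProb A z) z := by
    intro n
    induction n with
    | zero => exact fun z => sub_nonneg.2 measureReal_le_one
    | succ n ih =>
      intro z
      rw [Function.iterate_succ_apply', avg]
      exact mul_nonneg (by positivity) (Finset.sum_nonneg fun i _ => add_nonneg (ih _) (ih _))
  have hs : ∀ y ∈ A, Summable fun n => escapeProb A y * heat d n (x - y) :=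
    fun y _ => (summable_heat hd (x - y)).mul_left _
  have : ∑ y ∈ A, escapeProb A y * greenFn d (x - y) =
      ∑' n, ∑ y ∈ A, escapeProb A y * heat d n (x - y) := by
    rw [Summable.tsum_finsetSum hs]
    simp only [greenFn, tsum_mul_left]
  rw [this]
  refine Real.tsum_le_of_sum_range_le (fun n => Finset.sum_nonneg fun y _ =>
    mul_nonneg (escapeProb_nonneg A y) (heat_nonneg d n _)) fun n => ?_
  rw [sum_heat_mul_escapeProb hd0]
  have h1 : 0 ≤ avoidProb A x := measureReal_nonneg
  linarith [h0 n x]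

/-- The equilibrium potential equals `1` on the set: by transience the walk has a last visit. -/
theorem sum_escapeProb_mul_greenFn_eq_one {d : ℕ} (hd : 3 ≤ d) {A : Finset (Fin d → ℤ)}
    {x : Fin d → ℤ} (hx : x ∈ A) : ∑ y ∈ A, escapeProb A y * greenFn d (x - y) = 1 := by
  have hd0 : 0 < d := by omega
  have := isProbabilityMeasure_stepsMeasure hd0
  have hmono : ∀ (n : ℕ) (φ ψ : (Fin d → ℤ) → ℝ), φ ≤ ψ → avg^[n] φ ≤ avg^[n] ψ := by
    intro n
    induction n with
    | zero => exact fun _ _ h => h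
    | succ n ih => exact fun φ ψ h => ih _ _ (avg_mono h)
  -- the hitting probability is dominated by a Green potential, whose iterated averages are the tails
  -- of a convergent series
  have htail : ∀ n, avg^[n] (fun z => ∑ y ∈ A, greenFn d (z - y)) =
      fun z => ∑ y ∈ A, ∑' k, heat d (k + n) (z - y) := by
    intro n
    induction n with
    | zero => rfl
    | succ n ih =>
      rw [Function.iterate_succ_apply', ih]
      have : (fun z => ∑ y ∈ A, ∑' k, heat d (k + n) (z - y)) =
          ∑ y ∈ A, fun z => ∑' k, heat d (k + n) (z - y) := by
        funext z; simp
      rw [this, avg_sum]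
      funext z
      rw [Finset.sum_apply]
      refine Finset.sum_congr rfl fun y _ => ?_
      rw [avg_translate (fun z => ∑' k, heat d (k + n) z)]
      have hs : ∀ w, Summable fun k => heat d (k + n) w := fun w =>
        (summable_nat_add_iff n).2 (summable_heat hd w)
      simp only [avg, ← add_assoc, add_right_comm _ n 1]
      rw [show (fun k => heat d (k + 1 + n) (z - y)) = fun k => (2 * d : ℝ)⁻¹ * ∑ i,
        (heat d (k + n) (z - y + Pi.single i 1) + heat d (k + n) (z - y + Pi.single i (-1))) by
          funext k; rw [add_right_comm, heat_succ, avg], tsum_mul_left,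
        Summable.tsum_finsetSum fun i _ => (hs _).add (hs _)]
      congr 1
      exact Finset.sum_congr rfl fun i _ => ((hs _).tsum_add (hs _)).symm
  have hlim : Filter.Tendsto (fun n => avg^[n] (fun z => 1 - avoidProb A z) x) Filter.atTop
      (nhds 0) := by
    have h1 : Filter.Tendsto (fun n => ∑ y ∈ A, ∑' k, heat d (k + n) (x - y)) Filter.atTop
        (nhds (∑ y ∈ A, 0)) :=
      tendsto_finsetSum _ fun y _ => tendsto_sum_nat_add fun k => heat d k (x - y)
    rw [Finset.sum_const_zero] at h1
    refine squeeze_zero (fun n => ?_) (fun n => ?_) h1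
    · have h := hmono n (fun _ => 0) (fun z => 1 - avoidProb A z)
        fun z => sub_nonneg.2 measureReal_le_one
      have h0 : ∀ n : ℕ, avg^[n] (fun _ : Fin d → ℤ => (0 : ℝ)) = fun _ => 0 := fun n =>
        Function.iterate_fixed (avg_const hd0.ne' 0) n
      rw [h0] at h
      exact h x
    · have h := hmono n _ _ (fun z => one_sub_avoidProb_le hd A z)
      rw [htail] at h
      exact h x
  have h1 : HasSum (fun n => ∑ y ∈ A, escapeProb A y * heat d n (x - y))
      (∑ y ∈ A, escapeProb A y * greenFn d (x - y)) :=
    hasSum_sum fun y _ => (summable_heat hd (x - y)).hasSum.mul_left _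
  refine tendsto_nhds_unique h1.tendsto_sum_nat ?_
  simp only [sum_heat_mul_escapeProb hd0, avoidProb_of_mem hx, sub_zero]
  simpa using hlim.const_sub 1

/-! ### From continuous time to the discrete skeleton -/

/-- The law of the sequence of holding times. -/
noncomputable def holdingMeasure : Measure (ℕ → ℝ) := Measure.infinitePi fun _ : ℕ => expMeasure 1

instance : IsProbabilityMeasure (expMeasure 1) := isProbabilityMeasure_expMeasure one_pos

instance : IsProbabilityMeasure holdingMeasure := by
  unfold holdingMeasure
  infer_instance

theorem walkMeasure_eq (d : ℕ) : walkMeasure d = (stepsMeasure d).prod holdingMeasure := rfl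

theorem expMeasure_ae_pos : ∀ᵐ t ∂expMeasure 1, 0 < t := by
  rw [ae_iff]
  have : {t : ℝ | ¬ 0 < t} = Set.Iic 0 := by ext; simp
  rw [this, expMeasure, gammaMeasure, withDensity_apply _ measurableSet_Iic,
    setLIntegral_congr Iio_ae_eq_Iic.symm]
  exact lintegral_gammaPDF_of_nonpos le_rfl

theorem lintegral_ofReal_expMeasure : ∫⁻ t, ENNReal.ofReal t ∂expMeasure 1 = 1 := by
  rw [expMeasure, gammaMeasure, lintegral_withDensity_eq_lintegral_mul _
    (by unfold gammaPDF; exact (measurable_gammaPDFReal 1 1).ennreal_ofReal)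
    ENNReal.measurable_ofReal, ← lintegral_gammaPDF_eq_one (a := 2) (r := 1) two_pos one_pos]
  refine lintegral_congr fun t => ?_
  rw [Pi.mul_apply]
  rcases lt_or_ge t 0 with ht | ht
  · rw [gammaPDF_of_neg ht, gammaPDF_of_neg ht, zero_mul]
  · rw [gammaPDF_of_nonneg ht, gammaPDF_of_nonneg ht, ← ENNReal.ofReal_mul (by positivity),
      Real.Gamma_two, Real.Gamma_one]
    congr 1
    norm_num
    ring

theorem integrable_id_expMeasure : Integrable (fun t : ℝ => t) (expMeasure 1) := by
  refine ⟨measurable_id.aestronglyMeasurable, ?_⟩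
  rw [hasFiniteIntegral_iff_ofReal (expMeasure_ae_pos.mono fun t ht => ht.le),
    lintegral_ofReal_expMeasure]
  exact ENNReal.one_lt_top

theorem integral_id_expMeasure : ∫ t, t ∂expMeasure 1 = 1 := by
  rw [integral_eq_lintegral_of_nonneg_ae (expMeasure_ae_pos.mono fun t ht => ht.le)
    measurable_id.aestronglyMeasurable, lintegral_ofReal_expMeasure, ENNReal.toReal_one]

/-- A sequence of holding times is regular if the holding times are positive and the jump times
tend to infinity. -/
def IsRegular (w : ℕ → ℝ) : Prop :=
  (∀ n, 0 < w n) ∧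
    Filter.Tendsto (fun n => ∑ k ∈ Finset.range n, w k) Filter.atTop Filter.atTop

/-- The jump times tend to infinity by the strong law of large numbers. -/
theorem ae_isRegular : ∀ᵐ w ∂holdingMeasure, IsRegular w := by
  have hmap : ∀ n : ℕ, holdingMeasure.map (fun w => w n) = expMeasure 1 :=
    fun n => Measure.infinitePi_map_eval _ n
  have hpos : ∀ᵐ w ∂holdingMeasure, ∀ n, 0 < w n := by
    refine ae_all_iff.2 fun n => ?_
    have := expMeasure_ae_pos
    rw [← hmap n] at this
    exact ae_of_ae_map (measurable_pi_apply n).aemeasurable this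
  have hid : ∀ n : ℕ, IdentDistrib (fun w : ℕ → ℝ => w n) (fun w => w 0) holdingMeasure
      holdingMeasure := fun n =>
    ⟨(measurable_pi_apply n).aemeasurable, (measurable_pi_apply 0).aemeasurable, by
      rw [hmap, hmap]⟩
  have hint : Integrable (fun w : ℕ → ℝ => w 0) holdingMeasure := by
    have := integrable_id_expMeasure
    rw [← hmap 0] at this
    exact this.comp_measurable (measurable_pi_apply 0)
  have hind : iIndepFun (fun (n : ℕ) (w : ℕ → ℝ) => w n) holdingMeasure :=
    iIndepFun_infinitePi (P := fun _ : ℕ => expMeasure 1) (X := fun _ t => t)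
      fun _ => measurable_id
  have hmean : ∫ w, w 0 ∂holdingMeasure = 1 := by
    have := integral_map (μ := holdingMeasure) (φ := fun w : ℕ → ℝ => w 0) (f := fun t : ℝ => t)
      (measurable_pi_apply 0).aemeasurable measurable_id.aestronglyMeasurable
    rw [hmap 0, integral_id_expMeasure] at this
    exact this.symm
  have hlln := strong_law_ae_real (fun (n : ℕ) (w : ℕ → ℝ) => w n) hint
    (fun i j hij => hind.indepFun hij) hid
  filter_upwards [hpos, hlln] with w h1 h2
  refine ⟨h1, ?_⟩
  rw [hmean] at h2
  refine (h2.pos_mul_atTop one_pos tendsto_natCast_atTop_atTop).congr' ?_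
  filter_upwards [Filter.eventually_gt_atTop 0] with n hn
  have : (n : ℝ) ≠ 0 := by exact_mod_cast hn.ne'
  field_simp

theorem jumpTime_succ {d : ℕ} (ω : Sample d) (n : ℕ) :
    jumpTime ω (n + 1) = jumpTime ω n + ω.2 n := Finset.sum_range_succ _ _

theorem strictMono_jumpTime {d : ℕ} {ω : Sample d} (h : IsRegular ω.2) :
    StrictMono (jumpTime ω) :=
  strictMono_nat_of_lt_succ fun n => by rw [jumpTime_succ]; linarith [h.1 n]

theorem jumpCount_eq_iff {d : ℕ} {ω : Sample d} (h : IsRegular ω.2) {t : ℝ} (ht : 0 ≤ t) (n : ℕ) :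
    jumpCount ω t = n ↔ jumpTime ω n ≤ t ∧ t < jumpTime ω (n + 1) := by
  have hmono := strictMono_jumpTime h
  have hbdd : BddAbove {n : ℕ | jumpTime ω n ≤ t} := by
    obtain ⟨m, hm⟩ := (h.2.eventually_gt_atTop t).exists
    refine ⟨m, fun k hk => ?_⟩
    by_contra hlt
    push Not at hlt
    have h1 : jumpTime ω m < jumpTime ω k := hmono hlt
    have h2 : t < jumpTime ω m := hm
    have h3 : jumpTime ω k ≤ t := hk
    linarith
  have hne : {n : ℕ | jumpTime ω n ≤ t}.Nonempty := ⟨0, by simpa [jumpTime] using ht⟩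
  have hkey : ∀ n, jumpTime ω n ≤ t ↔ n ≤ jumpCount ω t := by
    intro n
    refine ⟨fun hn => le_csSup hbdd hn, fun hn => (hmono.monotone hn).trans ?_⟩
    exact Nat.sSup_mem hne hbdd
  rw [hkey, ← not_le, hkey]
  omega

/-- The walk spends at `y` the holding times that follow the visits of its skeleton to `y`. -/
theorem volume_walk_eq {d : ℕ} {ω : Sample d} (h : IsRegular ω.2) (x y : Fin d → ℤ) :
    ∫⁻ s in Set.Ici (0 : ℝ), Set.indicator {t : ℝ | walk x ω t = y} 1 s =
      ∑' n, ENNReal.ofReal (ω.2 n) * Set.indicator {ω' | skeleton x ω' n = y} 1 ω := by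
  classical
  have hmono := strictMono_jumpTime h
  have h0 : jumpTime ω 0 = 0 := by simp [jumpTime]
  set E : ℕ → Set ℝ := fun n =>
    if skeleton x ω n = y then Set.Ico (jumpTime ω n) (jumpTime ω (n + 1)) else ∅ with hE
  have hEm : ∀ n, MeasurableSet (E n) := fun n => by
    simp only [hE]; split_ifs; exacts [measurableSet_Ico, .empty]
  have hnonneg : ∀ n, 0 ≤ jumpTime ω n := fun n => h0 ▸ hmono.monotone (Nat.zero_le n)
  have hset : Set.Ici (0 : ℝ) ∩ {t | walk x ω t = y} = ⋃ n, E n := by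
    ext t
    simp only [Set.mem_inter_iff, Set.mem_Ici, Set.mem_ofPred_eq, Set.mem_iUnion, hE]
    constructor
    · rintro ⟨ht, hw⟩
      refine ⟨jumpCount ω t, ?_⟩
      rw [walk] at hw
      rw [if_pos hw]
      exact (jumpCount_eq_iff h ht _).1 rfl
    · rintro ⟨n, hn⟩
      split_ifs at hn with hs
      · have ht : 0 ≤ t := (hnonneg n).trans hn.1
        refine ⟨ht, ?_⟩
        rw [walk, (jumpCount_eq_iff h ht n).2 hn, hs]
      · simp at hn
  have hdisj : Pairwise (Function.onFun Disjoint E) := by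
    intro m n hmn
    refine Set.disjoint_left.2 fun t hm hn => hmn ?_
    simp only [hE] at hm hn
    split_ifs at hm hn
    · have ht : 0 ≤ t := (hnonneg m).trans hm.1
      rw [← (jumpCount_eq_iff h ht m).2 hm, (jumpCount_eq_iff h ht n).2 hn]
    all_goals simp_all
  have hU : MeasurableSet (⋃ n, E n) := .iUnion hEm
  have hind : ∀ s ∈ Set.Ici (0 : ℝ), Set.indicator {t : ℝ | walk x ω t = y} (1 : ℝ → ℝ≥0∞) s =
      Set.indicator (⋃ n, E n) 1 s := by
    intro s hs
    rw [← hset]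
    simp [Set.indicator, Set.mem_Ici.1 hs]
  rw [setLIntegral_congr_fun measurableSet_Ici hind, lintegral_indicator_one hU,
    Measure.restrict_apply hU, Set.inter_eq_left.2, measure_iUnion hdisj hEm]
  · refine tsum_congr fun n => ?_
    simp only [hE]
    by_cases hs : skeleton x ω n = y
    · rw [if_pos hs, Real.volume_Ico, jumpTime_succ]
      simp [Set.indicator, hs]
    · rw [if_neg hs]
      simp [Set.indicator, hs]
  · rw [← hset]
    exact Set.inter_subset_left

theorem ae_walkMeasure_isRegular {d : ℕ} (hd : 0 < d) :
    ∀ᵐ ω ∂walkMeasure d, IsRegular ω.2 := by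
  have := isProbabilityMeasure_stepsMeasure hd
  rw [walkMeasure_eq]
  exact Measure.quasiMeasurePreserving_snd.ae ae_isRegular

/-- The Green function of the continuous-time walk is that of its skeleton, since the holding times
have mean `1` and are independent of the skeleton. -/
theorem green_eq_greenFn {d : ℕ} (hd : 3 ≤ d) (x y : Fin d → ℤ) :
    green x y = greenFn d (x - y) := by
  have hd0 : 0 < d := by omega
  have := isProbabilityMeasure_stepsMeasure hd0
  have hms : ∀ n, MeasurableSet {ω : ℕ → Fin d → ℤ | x + ∑ k ∈ Finset.range n, ω k = y} :=
    fun n => measurableSet_partialSum_mem n x {y}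
  have hterm : ∀ n, ∫⁻ ω, ENNReal.ofReal (ω.2 n) *
      Set.indicator {ω' : Sample d | skeleton x ω' n = y} 1 ω ∂walkMeasure d =
        ENNReal.ofReal (heat d n (x - y)) := by
    intro n
    have hE : ∫⁻ w, ENNReal.ofReal (w n) ∂holdingMeasure = 1 := by
      have := lintegral_map (μ := holdingMeasure) (g := fun w : ℕ → ℝ => w n)
        ENNReal.measurable_ofReal (measurable_pi_apply n)
      rw [holdingMeasure, Measure.infinitePi_map_eval, lintegral_ofReal_expMeasure] at this
      exact this.symm
    rw [walkMeasure_eq]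
    have := lintegral_prod_mul (μ := stepsMeasure d) (ν := holdingMeasure)
      (f := Set.indicator {ω : ℕ → Fin d → ℤ | x + ∑ k ∈ Finset.range n, ω k = y} 1)
      (g := fun w => ENNReal.ofReal (w n))
      (measurable_one.indicator (hms n)).aemeasurable
      (ENNReal.measurable_ofReal.comp (measurable_pi_apply n)).aemeasurable
    rw [hE, mul_one, lintegral_indicator_one (hms n), ← ofReal_measureReal,
      stepsMeasure_real_partialSum_eq hd0] at this
    rw [← this]
    refine lintegral_congr fun ω => ?_
    rw [mul_comm]
    rfl
  have hsum : ∫⁻ ω, (∫⁻ s in Set.Ici (0 : ℝ), Set.indicator {t : ℝ | walk x ω t = y} 1 s)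
      ∂walkMeasure d = ENNReal.ofReal (greenFn d (x - y)) := by
    rw [lintegral_congr_ae ((ae_walkMeasure_isRegular hd0).mono fun ω h => volume_walk_eq h x y),
      lintegral_tsum, greenFn,
      ENNReal.ofReal_tsum_of_nonneg (fun n => heat_nonneg d n _) (summable_heat hd _)]
    · exact tsum_congr hterm
    · intro n
      have h1 : Measurable fun ω : Sample d => ENNReal.ofReal (ω.2 n) :=
        ENNReal.measurable_ofReal.comp ((measurable_pi_apply n).comp measurable_snd)
      have h2 : MeasurableSet {ω' : Sample d | skeleton x ω' n = y} := measurable_fst (hms n)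
      exact (h1.mul (measurable_one.indicator h2)).aemeasurable
  rw [green, hsum, ENNReal.toReal_ofReal (greenFn_nonneg d _)]

theorem hittingTime_eq_top_iff {d : ℕ} {ω : Sample d} (h : IsRegular ω.2) (x : Fin d → ℤ)
    (A : Set (Fin d → ℤ)) :
    hittingTime x A ω = ⊤ ↔ ∀ n, skeleton x ω (n + 1) ∉ A := by
  have hmono := strictMono_jumpTime h
  have h0 : jumpTime ω 0 = 0 := by simp [jumpTime]
  have hnonneg : ∀ n, 0 ≤ jumpTime ω n := fun n => h0 ▸ hmono.monotone (Nat.zero_le n)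
  simp only [hittingTime, iInf_eq_top, ENNReal.ofReal_ne_top, imp_false, not_and]
  constructor
  · intro hA n
    have := hA (jumpTime ω (n + 1)) (hmono.monotone (by omega))
    rwa [walk, (jumpCount_eq_iff h (hnonneg _) (n + 1)).2 ⟨le_rfl, hmono (Nat.lt_succ_self _)⟩]
      at this
  · intro hA t ht
    have h1 := (jumpCount_eq_iff h ((hnonneg 1).trans ht) _).1 rfl
    have h2 : jumpCount ω t ≠ 0 := by
      intro h2
      rw [h2] at h1
      exact absurd ht (not_le.2 h1.2)
    obtain ⟨m, hm⟩ := Nat.exists_eq_succ_of_ne_zero h2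
    rw [walk, hm]
    exact hA m

theorem capacity_eq {d : ℕ} (hd : 0 < d) (A : Finset (Fin d → ℤ)) :
    capacity A = ∑ x ∈ A, escapeProb A x := by
  have := isProbabilityMeasure_stepsMeasure hd
  refine Finset.sum_congr rfl fun x _ => ?_
  have h : {ω | hittingTime x (A : Set (Fin d → ℤ)) ω = ⊤} =ᵐ[walkMeasure d]
      {ω : ℕ → Fin d → ℤ | ∀ n, x + ∑ k ∈ Finset.range (n + 1), ω k ∉ A} ×ˢ
        (Set.univ : Set (ℕ → ℝ)) := by
    filter_upwards [ae_walkMeasure_isRegular hd] with ω hω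
    refine propext ((hittingTime_eq_top_iff hω x A).trans ?_)
    exact ⟨fun h => ⟨fun n hn => h n hn, trivial⟩, fun h n hn => h.1 n hn⟩
  rw [measureReal_congr h, walkMeasure_eq, Measure.real, Measure.prod_prod, measure_univ, mul_one]
  rfl

theorem capacity_nonneg {d : ℕ} (A : Finset (Fin d → ℤ)) : 0 ≤ capacity A :=
  Finset.sum_nonneg fun _ _ => measureReal_nonneg

/-! ### The constant `cStar` -/

/-- The supremum defining `cStar` is over a bounded set, hence an upper bound. -/
theorem greenFn_mul_euclNorm_le_cStar {d : ℕ} (hd : 3 ≤ d) (x : Fin d → ℤ) :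
    greenFn d x * euclNorm x ^ (d - 2) ≤ cStar d := by
  obtain ⟨C, hC⟩ := exists_greenFn_mul_le hd
  refine le_csSup ⟨C, ?_⟩ ⟨0, x, ?_⟩
  · rintro r ⟨x, y, rfl⟩
    rw [green_eq_greenFn hd, ← greenFn_neg, neg_sub]
    exact hC _
  · rw [green_eq_greenFn hd, zero_sub, greenFn_neg, sub_zero]

theorem cStar_nonneg {d : ℕ} (hd : 3 ≤ d) : 0 ≤ cStar d :=
  (mul_nonneg (greenFn_nonneg d 0) (pow_nonneg (Real.sqrt_nonneg _) _)).trans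
    (greenFn_mul_euclNorm_le_cStar hd 0)

/-! ### Sums of the Green function over boxes -/

/-- The supremum norm of a lattice point, as a natural number. -/
def supNorm {d : ℕ} (x : Fin d → ℤ) : ℕ := Finset.univ.sup fun i => (x i).natAbs

theorem supNorm_le_iff {d : ℕ} {x : Fin d → ℤ} {r : ℕ} :
    supNorm x ≤ r ↔ ∀ i, (x i).natAbs ≤ r := by
  simp [supNorm]

theorem natAbs_le_supNorm {d : ℕ} (x : Fin d → ℤ) (i : Fin d) : (x i).natAbs ≤ supNorm x :=
  supNorm_le_iff.1 le_rfl i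

theorem supNorm_eq_zero {d : ℕ} {x : Fin d → ℤ} : supNorm x = 0 ↔ x = 0 := by
  rw [← Nat.le_zero, supNorm_le_iff, funext_iff]
  simp

theorem supNorm_le_euclNorm {d : ℕ} (x : Fin d → ℤ) : (supNorm x : ℝ) ≤ euclNorm x := by
  rw [euclNorm, ← Nat.le_floor_iff (Real.sqrt_nonneg _), supNorm_le_iff]
  intro i
  rw [Nat.le_floor_iff (Real.sqrt_nonneg _), Nat.cast_natAbs, Int.cast_abs]
  refine Real.abs_le_sqrt ?_
  exact Finset.single_le_sum (f := fun i => (x i : ℝ) ^ 2) (fun _ _ => sq_nonneg _)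
    (Finset.mem_univ i)

theorem greenFn_le_cStar_div {d : ℕ} (hd : 3 ≤ d) {x : Fin d → ℤ} (hx : x ≠ 0) :
    greenFn d x ≤ cStar d * ((supNorm x : ℝ) ^ (d - 2))⁻¹ := by
  have h0 : 0 < supNorm x := Nat.pos_of_ne_zero fun h => hx (supNorm_eq_zero.1 h)
  have h1 : (0 : ℝ) < (supNorm x : ℝ) ^ (d - 2) := pow_pos (by exact_mod_cast h0) _
  rw [← div_eq_mul_inv, le_div_iff₀ h1]
  refine le_trans ?_ (greenFn_mul_euclNorm_le_cStar hd x)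
  exact mul_le_mul_of_nonneg_left (pow_le_pow_left₀ (by positivity) (supNorm_le_euclNorm x) _)
    (greenFn_nonneg d x)

theorem add_two_pow_le (a n : ℕ) : (a + 2) ^ (n + 1) ≤ a ^ (n + 1) + 2 * (n + 1) * (a + 2) ^ n := by
  induction n with
  | zero => simp
  | succ n ih =>
    have h : a ^ (n + 1) ≤ (a + 2) ^ (n + 1) := Nat.pow_le_pow_left (by omega) _
    calc (a + 2) ^ (n + 1 + 1) = (a + 2) * (a + 2) ^ (n + 1) := by ring
      _ ≤ (a + 2) * (a ^ (n + 1) + 2 * (n + 1) * (a + 2) ^ n) := Nat.mul_le_mul_left _ ih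
      _ = a ^ (n + 1 + 1) + 2 * a ^ (n + 1) + 2 * (n + 1) * (a + 2) ^ (n + 1) := by ring
      _ ≤ a ^ (n + 1 + 1) + 2 * (a + 2) ^ (n + 1) + 2 * (n + 1) * (a + 2) ^ (n + 1) := by omega
      _ = _ := by ring

/-- A sphere of the supremum norm, as the difference of two consecutive balls. -/
theorem card_sphere_le {d : ℕ} (hd : 0 < d) {r : ℕ} (hr : 0 < r) {S : Finset (Fin d → ℤ)}
    (hS : ∀ y ∈ S, supNorm y = r) : S.card ≤ 2 * d * (3 * r) ^ (d - 1) := by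
  obtain ⟨s, rfl⟩ : ∃ s, r = s + 1 := ⟨r - 1, by omega⟩
  obtain ⟨n, rfl⟩ : ∃ n, d = n + 1 := ⟨d - 1, by omega⟩
  set ball : ℕ → Finset (Fin (n + 1) → ℤ) := fun r =>
    Fintype.piFinset fun _ => Finset.Icc (-(r : ℤ)) r with hball
  have hmem : ∀ r y, y ∈ ball r ↔ supNorm y ≤ r := by
    intro r y
    simp only [hball, Fintype.mem_piFinset, Finset.mem_Icc, supNorm_le_iff]
    exact forall_congr' fun i => by omega
  have hcard : ∀ r, (ball r).card = (2 * r + 1) ^ (n + 1) := by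
    intro r
    simp only [hball, Fintype.card_piFinset, Int.card_Icc, Finset.prod_const, Finset.card_univ,
      Fintype.card_fin]
    congr 1
    omega
  have hsub : S ∪ ball s ⊆ ball (s + 1) := by
    intro y hy
    rw [hmem]
    rcases Finset.mem_union.1 hy with h | h
    · exact (hS y h).le
    · exact ((hmem s y).1 h).trans (by omega)
  have hdisj : Disjoint S (ball s) := Finset.disjoint_left.2 fun y h h' => by
    have := (hmem s y).1 h'
    rw [hS y h] at this
    omega
  have h1 := Finset.card_le_card hsub
  rw [Finset.card_union_of_disjoint hdisj, hcard, hcard] at h1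
  have h2 := add_two_pow_le (2 * s + 1) n
  have h3 : 2 * (s + 1) + 1 = 2 * s + 1 + 2 := by ring
  rw [h3] at h1
  have h4 : (2 * s + 1 + 2) ^ n ≤ (3 * (s + 1)) ^ n := Nat.pow_le_pow_left (by omega) _
  have h5 : 2 * (n + 1) * (2 * s + 1 + 2) ^ n ≤ 2 * (n + 1) * (3 * (s + 1)) ^ n :=
    Nat.mul_le_mul_left _ h4
  rw [Nat.add_sub_cancel]
  omega

theorem sum_inv_supNorm_pow_le {d : ℕ} (hd : 3 ≤ d) {R : ℕ} {S : Finset (Fin d → ℤ)}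
    (hS : ∀ y ∈ S, y ≠ 0 ∧ supNorm y < R) :
    ∑ y ∈ S, ((supNorm y : ℝ) ^ (d - 2))⁻¹ ≤ d * 3 ^ (d - 1) * (R : ℝ) ^ 2 := by
  have hmaps : ∀ y ∈ S, supNorm y ∈ Finset.range R := fun y hy => Finset.mem_range.2 (hS y hy).2
  rw [← Finset.sum_fiberwise_of_maps_to hmaps]
  have hfib : ∀ r ∈ Finset.range R,
      ∑ y ∈ S with supNorm y = r, ((supNorm y : ℝ) ^ (d - 2))⁻¹ ≤ d * 3 ^ (d - 1) * (r * 2) := by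
    intro r _
    rcases Nat.eq_zero_or_pos r with rfl | hr
    · rw [Finset.sum_eq_zero]
      · simp
      · intro y hy
        rw [Finset.mem_filter, supNorm_eq_zero] at hy
        exact absurd hy.2 (hS y hy.1).1
    · have hr' : (0 : ℝ) < r := by exact_mod_cast hr
      have hc := card_sphere_le (by omega) hr (S := {y ∈ S | supNorm y = r})
        fun y hy => (Finset.mem_filter.1 hy).2
      have hc' : (({y ∈ S | supNorm y = r} : Finset _).card : ℝ) ≤
          2 * d * (3 * (r : ℝ)) ^ (d - 1) := by exact_mod_cast hc
      calc _ = ∑ y ∈ S with supNorm y = r, ((r : ℝ) ^ (d - 2))⁻¹ :=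
            Finset.sum_congr rfl fun y hy => by rw [(Finset.mem_filter.1 hy).2]
        _ = ({y ∈ S | supNorm y = r} : Finset _).card * ((r : ℝ) ^ (d - 2))⁻¹ := by
            rw [Finset.sum_const, nsmul_eq_mul]
        _ ≤ 2 * d * (3 * (r : ℝ)) ^ (d - 1) * ((r : ℝ) ^ (d - 2))⁻¹ := by gcongr
        _ = _ := by
            have : d - 1 = d - 2 + 1 := by omega
            rw [mul_pow, this, pow_succ (r : ℝ)]
            field_simp
  refine (Finset.sum_le_sum hfib).trans ?_
  rw [← Finset.mul_sum, ← Finset.sum_mul]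
  refine mul_le_mul_of_nonneg_left ?_ (by positivity)
  have h := Finset.sum_range_id_mul_two R
  have h' : (∑ r ∈ Finset.range R, (r : ℝ)) * 2 = ((R * (R - 1) : ℕ) : ℝ) := by
    rw [← h]; push_cast; rfl
  rw [h', sq]
  exact_mod_cast Nat.mul_le_mul_left R (Nat.sub_le R 1)

/-! ### The grid of `M`-adic boxes -/

/-- The side length of the `M`-adic boxes of depth `ℓ`. -/
def side (M L n ℓ : ℕ) : ℕ := M ^ (n - ℓ) * L

/-- The index of the `M`-adic box of depth `ℓ` containing `x`. -/
def cellIdx {d : ℕ} (M L n ℓ : ℕ) (x : Fin d → ℤ) : Fin d → ℤ := fun i => x i / side M L n ℓ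

/-- The `M`-adic box of depth `ℓ` with index `z`. -/
noncomputable def gridBox {d : ℕ} (M L n ℓ : ℕ) (z : Fin d → ℤ) : Finset (Fin d → ℤ) :=
  box (fun i => (side M L n ℓ : ℤ) * z i) (side M L n ℓ)

theorem side_pos {M L n ℓ : ℕ} (hM : 0 < M) (hL : 0 < L) : 0 < side M L n ℓ := by
  unfold side; positivity

theorem side_succ {M L n ℓ : ℕ} (h : ℓ < n) : side M L n ℓ = M * side M L n (ℓ + 1) := by
  rw [side, side, ← mul_assoc, ← pow_succ']
  congr 2
  omega

theorem side_eq_mul {M L n ℓ ℓ' : ℕ} (h : ℓ ≤ ℓ') (hn : ℓ' ≤ n) :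
    side M L n ℓ = M ^ (ℓ' - ℓ) * side M L n ℓ' := by
  rw [side, side, ← mul_assoc, ← pow_add]
  congr 2
  omega

theorem mem_gridBox {d M L n ℓ : ℕ} (hR : 0 < side M L n ℓ) {z y : Fin d → ℤ} :
    y ∈ gridBox M L n ℓ z ↔ cellIdx M L n ℓ y = z := by
  have hR' : (0 : ℤ) < side M L n ℓ := by exact_mod_cast hR
  rw [gridBox, mem_box, funext_iff]
  refine forall_congr' fun i => ?_
  rw [cellIdx, Int.ediv_eq_iff_of_pos hR']
  constructor <;> rintro ⟨h1, h2⟩ <;> constructor <;> linarith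

theorem mem_gridBox_cellIdx {d M L n ℓ : ℕ} (hR : 0 < side M L n ℓ) (x : Fin d → ℤ) :
    x ∈ gridBox M L n ℓ (cellIdx M L n ℓ x) :=
  (mem_gridBox hR).2 rfl

theorem card_gridBox {d : ℕ} (M L n ℓ : ℕ) (z : Fin d → ℤ) :
    (gridBox M L n ℓ z).card = side M L n ℓ ^ d := by
  simp [gridBox, box]

theorem adicBoxes_eq {d M L n ℓ : ℕ} :
    adicBoxes d M L n ℓ = Set.range (gridBox M L n ℓ) := by
  ext B
  exact exists_congr fun z => eq_comm

/-- Boxes of larger depth refine boxes of smaller depth. -/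
theorem cellIdx_eq_of_le {d M L n ℓ ℓ' : ℕ} (h : ℓ ≤ ℓ') (hn : ℓ' ≤ n) {x y : Fin d → ℤ}
    (hxy : cellIdx M L n ℓ' x = cellIdx M L n ℓ' y) : cellIdx M L n ℓ x = cellIdx M L n ℓ y := by
  funext i
  have := congrFun hxy i
  simp only [cellIdx] at this ⊢
  rw [side_eq_mul h hn, mul_comm]
  push_cast
  rw [← Int.ediv_ediv_of_nonneg (by positivity), ← Int.ediv_ediv_of_nonneg (by positivity), this]

theorem supNorm_sub_lt {d M L n ℓ : ℕ} (hR : 0 < side M L n ℓ) {z x y : Fin d → ℤ}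
    (hx : x ∈ gridBox M L n ℓ z) (hy : y ∈ gridBox M L n ℓ z) :
    supNorm (x - y) < side M L n ℓ := by
  rw [gridBox, mem_box] at hx hy
  rw [Nat.lt_iff_le_pred hR, supNorm_le_iff]
  intro i
  have h1 := hx i
  have h2 := hy i
  rw [Pi.sub_apply]
  omega

theorem sum_greenFn_le {d M L n ℓ : ℕ} (hd : 3 ≤ d) (hR : 0 < side M L n ℓ) {z x : Fin d → ℤ}
    (hx : x ∈ gridBox M L n ℓ z) :
    ∑ y ∈ gridBox M L n ℓ z, greenFn d (y - x) ≤
      (greenFn d 0 + cStar d * (d * 3 ^ (d - 1))) * (side M L n ℓ : ℝ) ^ 2 := by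
  classical
  have hR1 : (1 : ℝ) ≤ (side M L n ℓ : ℝ) ^ 2 := one_le_pow₀ (by exact_mod_cast hR)
  have h1 : ∑ y ∈ (gridBox M L n ℓ z).erase x, greenFn d (y - x) ≤
      cStar d * (d * 3 ^ (d - 1) * (side M L n ℓ : ℝ) ^ 2) := by
    have hinj : Set.InjOn (fun y => y - x) ((gridBox M L n ℓ z).erase x : Set (Fin d → ℤ)) :=
      fun _ _ _ _ h => sub_left_injective h
    have h2 := sum_inv_supNorm_pow_le hd (R := side M L n ℓ)
      (S := ((gridBox M L n ℓ z).erase x).image fun y => y - x) ?_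
    · rw [Finset.sum_image hinj] at h2
      calc _ ≤ ∑ y ∈ (gridBox M L n ℓ z).erase x,
              cStar d * ((supNorm (y - x) : ℝ) ^ (d - 2))⁻¹ :=
            Finset.sum_le_sum fun y hy =>
              greenFn_le_cStar_div hd (sub_ne_zero.2 (Finset.ne_of_mem_erase hy))
        _ ≤ _ := by
            rw [← Finset.mul_sum]
            exact mul_le_mul_of_nonneg_left h2 (cStar_nonneg hd)
    · intro w hw
      obtain ⟨y, hy, rfl⟩ := Finset.mem_image.1 hw
      exact ⟨sub_ne_zero.2 (Finset.ne_of_mem_erase hy),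
        supNorm_sub_lt hR (Finset.mem_of_mem_erase hy) hx⟩
  rw [← Finset.add_sum_erase _ _ hx, sub_self]
  nlinarith [one_le_greenFn_zero hd]

theorem mem_interSet {d : ℕ} {B : Finset (Fin d → ℤ)} {F : Set (Fin d → ℤ)} {x : Fin d → ℤ} :
    x ∈ interSet B F ↔ x ∈ B ∧ x ∈ F := by
  simp [interSet]

theorem interSet_subset {d : ℕ} (B : Finset (Fin d → ℤ)) (F : Set (Fin d → ℤ)) :
    interSet B F ⊆ B := fun _ h => (mem_interSet.1 h).1

/-- Testing the identity `G e_A = 1` on `A` against the counting measure of `A`. -/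
theorem card_le_capacity {d M L n ℓ : ℕ} (hd : 3 ≤ d) (hR : 0 < side M L n ℓ) {z : Fin d → ℤ}
    {A : Finset (Fin d → ℤ)} (hA : A ⊆ gridBox M L n ℓ z) :
    (A.card : ℝ) ≤ (greenFn d 0 + cStar d * (d * 3 ^ (d - 1))) *
      ((side M L n ℓ : ℝ) ^ 2 * capacity A) := by
  calc (A.card : ℝ) = ∑ x ∈ A, ∑ y ∈ A, escapeProb A y * greenFn d (x - y) := by
        rw [Finset.sum_congr rfl fun x hx => sum_escapeProb_mul_greenFn_eq_one hd hx]
        simp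
    _ = ∑ y ∈ A, escapeProb A y * ∑ x ∈ A, greenFn d (x - y) := by
        rw [Finset.sum_comm]
        exact Finset.sum_congr rfl fun y _ => (Finset.mul_sum _ _ _).symm
    _ ≤ ∑ y ∈ A, escapeProb A y *
          ((greenFn d 0 + cStar d * (d * 3 ^ (d - 1))) * (side M L n ℓ : ℝ) ^ 2) := by
        refine Finset.sum_le_sum fun y hy => mul_le_mul_of_nonneg_left ?_ (escapeProb_nonneg A y)
        exact (Finset.sum_le_sum_of_subset_of_nonneg hA fun x _ _ => greenFn_nonneg d _).trans
          (sum_greenFn_le hd hR (hA hy))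
    _ = _ := by
        rw [← Finset.sum_mul, ← capacity_eq (by omega)]
        ring

/-- Comparison of capacities by duality: if a weighted sum of equilibrium potentials of subsets
`A j` of `A` is at most `K` on `A`, the weighted sum of their capacities is at most `K` times the
capacity of `A`. -/
theorem sum_mul_capacity_le {d : ℕ} (hd : 3 ≤ d) {ι : Type*} (C : Finset ι) (w : ι → ℝ)
    (A' : ι → Finset (Fin d → ℤ)) {A : Finset (Fin d → ℤ)} (hA : ∀ p ∈ C, A' p ⊆ A) {K : ℝ}
    (hK : ∀ x ∈ A, ∑ p ∈ C, w p * ∑ y ∈ A' p, escapeProb (A' p) y * greenFn d (x - y) ≤ K) :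
    ∑ p ∈ C, w p * capacity (A' p) ≤ K * capacity A := by
  have hd0 : 0 < d := by omega
  have h1 : ∀ p ∈ C, capacity (A' p) =
      ∑ x ∈ A, escapeProb A x * ∑ y ∈ A' p, escapeProb (A' p) y * greenFn d (x - y) := by
    intro p hp
    simp only [Finset.mul_sum]
    rw [Finset.sum_comm, capacity_eq hd0]
    refine Finset.sum_congr rfl fun y hy => ?_
    have := sum_escapeProb_mul_greenFn_eq_one hd (hA p hp hy)
    calc _ = escapeProb (A' p) y * 1 := (mul_one _).symm
      _ = _ := by
        rw [← this, Finset.mul_sum]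
        refine Finset.sum_congr rfl fun x _ => ?_
        rw [← greenFn_neg, neg_sub]
        ring
  calc _ = ∑ p ∈ C, w p *
        ∑ x ∈ A, escapeProb A x * ∑ y ∈ A' p, escapeProb (A' p) y * greenFn d (x - y) :=
        Finset.sum_congr rfl fun p hp => by rw [← h1 p hp]
    _ = ∑ x ∈ A, escapeProb A x *
        ∑ p ∈ C, w p * ∑ y ∈ A' p, escapeProb (A' p) y * greenFn d (x - y) := by
        simp only [Finset.mul_sum (s := A), Finset.mul_sum (s := C)]
        rw [Finset.sum_comm]
        exact Finset.sum_congr rfl fun x _ => Finset.sum_congr rfl fun p _ => by ring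
    _ ≤ ∑ x ∈ A, escapeProb A x * K :=
        Finset.sum_le_sum fun x hx => mul_le_mul_of_nonneg_left (hK x hx) (escapeProb_nonneg A x)
    _ = _ := by rw [← Finset.sum_mul, ← capacity_eq hd0, mul_comm]

/-! ### Capacities of small boxes inside a large box -/

/-- The room left by the boxes near a point for the contribution of all others. -/
theorem two_pow_mul_three_pow_le {d M : ℕ} (hd : 3 ≤ d) (hM : ∃ b : ℕ, M = 2 ^ b) (hM4 : 4 < M)
    (hMd : 3 ^ d + 1 < M ^ 2) :
    2 ^ (d - 2) * (d * 3 ^ (d - 1)) + 4 * M ^ (2 * d - 6) * (3 ^ d + 1) ≤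
      4 * M ^ (2 * d - 6) * M ^ 2 := by
  obtain ⟨b, rfl⟩ := hM
  have hb : 3 ≤ b := by
    by_contra h
    have : 2 ^ b ≤ 2 ^ 2 := Nat.pow_le_pow_right two_pos (by omega)
    omega
  rcases hd.eq_or_lt with rfl | hd4
  · have : 2 ^ 3 ≤ 2 ^ b := Nat.pow_le_pow_right two_pos hb
    norm_num at this ⊢
    nlinarith
  · obtain ⟨k, rfl⟩ : ∃ k, d = k + 4 := ⟨d - 4, by omega⟩
    -- the gap `M² - (3 ^ d + 1)` may be small here, but `M ≥ 16`, since `8² < 3⁴ + 1`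
    have hb4 : 4 ≤ b := by
      by_contra h
      obtain rfl : b = 3 := by omega
      have : 3 ^ 4 ≤ 3 ^ (k + 4) := Nat.pow_le_pow_right (by norm_num) (by omega)
      norm_num at this hMd
      omega
    have h16 : 2 ^ 4 ≤ 2 ^ b := Nat.pow_le_pow_right two_pos hb4
    generalize 2 ^ b = M at *
    have hK : ∀ k : ℕ, 2 ^ (k + 2) * ((k + 4) * 3 ^ (k + 3)) ≤ 4 * 256 ^ (k + 1) := by
      intro k
      induction k with
      | zero => norm_num
      | succ k ih =>
        calc 2 ^ (k + 1 + 2) * ((k + 1 + 4) * 3 ^ (k + 1 + 3))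
            = 6 * (2 ^ (k + 2) * ((k + 5) * 3 ^ (k + 3))) := by ring
          _ ≤ 6 * (2 ^ (k + 2) * ((2 * (k + 4)) * 3 ^ (k + 3))) := by gcongr; omega
          _ = 12 * (2 ^ (k + 2) * ((k + 4) * 3 ^ (k + 3))) := by ring
          _ ≤ 12 * (4 * 256 ^ (k + 1)) := Nat.mul_le_mul_left _ ih
          _ ≤ 4 * 256 ^ (k + 1 + 1) := by rw [pow_succ 256 (k + 1)]; omega
    have h1 : 4 * 256 ^ (k + 1) ≤ 4 * M ^ (2 * (k + 4) - 6) := by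
      have : 2 * (k + 4) - 6 = 2 * (k + 1) := by omega
      rw [this, pow_mul]
      gcongr
      nlinarith
    calc _ ≤ 4 * M ^ (2 * (k + 4) - 6) + 4 * M ^ (2 * (k + 4) - 6) * (3 ^ (k + 4) + 1) :=
          Nat.add_le_add_right ((hK k).trans h1) _
      _ = 4 * M ^ (2 * (k + 4) - 6) * (3 ^ (k + 4) + 1 + 1) := by ring
      _ ≤ _ := Nat.mul_le_mul_left _ hMd

theorem two_delta_mul_cStar_le {d : ℕ} (hd : 3 ≤ d) (M : ℕ) :
    2 * delta d M * cStar d ≤ (4 * (M : ℝ) ^ (2 * d - 2))⁻¹ := by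
  rcases (cStar_nonneg hd).eq_or_lt with h | h
  -- the case `cStar d = 0` does not occur, but is covered by the convention `0⁻¹ = 0`
  · rw [← h, mul_zero]; positivity
  · rw [delta]
    have : 2 * (1 / 2 * (4 * cStar d * (M : ℝ) ^ (2 * d - 2))⁻¹) * cStar d =
        (4 * (M : ℝ) ^ (2 * d - 2))⁻¹ := by
      rw [mul_right_comm 4, mul_inv _ (cStar d)]
      field_simp
    exact this.le

theorem delta_nonneg {d : ℕ} (hd : 3 ≤ d) (M : ℕ) : 0 ≤ delta d M := by
  have := cStar_nonneg hd
  unfold delta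
  positivity

theorem sum_side_sq {M L n ℓ m : ℕ} (h : ℓ ≤ m) (hmn : m ≤ n) :
    ((M : ℝ) ^ 2 - 1) * ∑ k ∈ Finset.Ioc ℓ m, (side M L n k : ℝ) ^ 2 =
      (side M L n ℓ : ℝ) ^ 2 - (side M L n m : ℝ) ^ 2 := by
  induction m, h using Nat.le_induction with
  | base => simp
  | succ m h ih =>
    rw [← Finset.insert_Ioc_right_eq_Ioc_add_one h, Finset.sum_insert (by simp), mul_add,
      ih (by omega), side_succ (show m < n by omega)]
    push_cast
    ring

/-- At each depth at most `3 ^ d` boxes are adjacent or equal to the box containing `x`. -/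
theorem sum_near_side_sq_le {d M L n ℓ : ℕ} (hM : 1 ≤ M) (hℓ : ℓ ≤ n) (x : Fin d → ℤ)
    (C : Finset (ℕ × (Fin d → ℤ)))
    (hC : ∀ p ∈ C, ℓ < p.1 ∧ p.1 ≤ n ∧ ∀ i, |p.2 i - cellIdx M L n p.1 x i| ≤ 1) :
    ((M : ℝ) ^ 2 - 1) * ∑ p ∈ C, (side M L n p.1 : ℝ) ^ 2 ≤ 3 ^ d * (side M L n ℓ : ℝ) ^ 2 := by
  classical
  have hmaps : ∀ p ∈ C, p.1 ∈ Finset.Ioc ℓ n := fun p hp =>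
    Finset.mem_Ioc.2 ⟨(hC p hp).1, (hC p hp).2.1⟩
  have hM' : (1 : ℝ) ≤ (M : ℝ) ^ 2 := one_le_pow₀ (by exact_mod_cast hM)
  have hcard : ∀ k, ({p ∈ C | p.1 = k} : Finset _).card ≤ 3 ^ d := by
    intro k
    have h3 : (Fintype.piFinset fun i : Fin d =>
        Finset.Icc (cellIdx M L n k x i - 1) (cellIdx M L n k x i + 1)).card = 3 ^ d := by
      simp only [Fintype.card_piFinset, Int.card_Icc]
      rw [Finset.prod_congr rfl (g := fun _ => 3) fun i _ => by omega]
      simp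
    rw [← h3]
    refine Finset.card_le_card_of_injOn Prod.snd ?_ ?_
    · intro p hp
      obtain ⟨hpC, rfl⟩ := Finset.mem_filter.1 (Finset.mem_coe.1 hp)
      refine Fintype.mem_piFinset.2 fun i => Finset.mem_Icc.2 ?_
      have := abs_le.1 ((hC p hpC).2.2 i)
      constructor <;> linarith
    · intro p hp p' hp' h
      exact Prod.ext ((Finset.mem_filter.1 hp).2.trans (Finset.mem_filter.1 hp').2.symm) h
  calc _ = ((M : ℝ) ^ 2 - 1) * ∑ k ∈ Finset.Ioc ℓ n,
          ∑ p ∈ C with p.1 = k, (side M L n p.1 : ℝ) ^ 2 := by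
        rw [Finset.sum_fiberwise_of_maps_to hmaps]
    _ = ((M : ℝ) ^ 2 - 1) * ∑ k ∈ Finset.Ioc ℓ n,
          (({p ∈ C | p.1 = k} : Finset _).card : ℝ) * (side M L n k : ℝ) ^ 2 := by
        congr 1
        refine Finset.sum_congr rfl fun k _ => ?_
        rw [Finset.sum_congr rfl (g := fun _ => (side M L n k : ℝ) ^ 2)
          fun p hp => by rw [(Finset.mem_filter.1 hp).2], Finset.sum_const, nsmul_eq_mul]
    _ ≤ ((M : ℝ) ^ 2 - 1) * ∑ k ∈ Finset.Ioc ℓ n, 3 ^ d * (side M L n k : ℝ) ^ 2 := by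
        refine mul_le_mul_of_nonneg_left (Finset.sum_le_sum fun k _ => ?_) (by linarith)
        refine mul_le_mul_of_nonneg_right ?_ (by positivity)
        exact_mod_cast hcard k
    _ = 3 ^ d * ((side M L n ℓ : ℝ) ^ 2 - (side M L n n : ℝ) ^ 2) := by
        rw [← Finset.mul_sum, mul_left_comm, sum_side_sq hℓ le_rfl]
    _ ≤ _ := by
        refine mul_le_mul_of_nonneg_left ?_ (by positivity)
        linarith [sq_nonneg (side M L n n : ℝ)]

/-- A point outside a box and its neighbours is at distance more than the side from the box, so its
distances to the points of the box are comparable. -/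
theorem supNorm_sub_le_two_mul {d M L n k : ℕ} (hR : 0 < side M L n k) {x y y' z : Fin d → ℤ}
    (hy : y ∈ gridBox M L n k z) (hy' : y' ∈ gridBox M L n k z)
    (hfar : ¬ ∀ i, |z i - cellIdx M L n k x i| ≤ 1) :
    0 < supNorm (x - y) ∧ supNorm (x - y') ≤ 2 * supNorm (x - y) := by
  have h1 : side M L n k ≤ supNorm (x - y) := by
    push Not at hfar
    obtain ⟨i, hi⟩ := hfar
    refine le_trans ?_ (natAbs_le_supNorm _ i)
    have hR' : (0 : ℤ) < side M L n k := by exact_mod_cast hR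
    have hy1 := mem_box.1 hy i
    have hx1 := mem_box.1 (mem_gridBox_cellIdx hR x) i
    rw [Pi.sub_apply]
    rcases lt_abs.1 hi with h | h
    · have : (side M L n k : ℤ) * (cellIdx M L n k x i + 2) ≤ side M L n k * z i :=
        mul_le_mul_of_nonneg_left (by linarith) hR'.le
      have h2 : (side M L n k : ℤ) * (cellIdx M L n k x i + 2) = side M L n k * cellIdx M L n k x i +
          side M L n k + side M L n k := by ring
      omega
    · have : (side M L n k : ℤ) * (z i + 2) ≤ side M L n k * cellIdx M L n k x i :=
        mul_le_mul_of_nonneg_left (by linarith) hR'.le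
      have h2 : (side M L n k : ℤ) * (z i + 2) = side M L n k * z i + side M L n k + side M L n k := by ring
      omega
  refine ⟨hR.trans_le h1, supNorm_le_iff.2 fun i => ?_⟩
  have h2 := natAbs_le_supNorm (x - y) i
  have h3 := natAbs_le_supNorm (y - y') i
  have h4 := supNorm_sub_lt hR hy hy'
  simp only [Pi.sub_apply] at h2 h3 ⊢
  omega

/-- The equilibrium potential of a set of small capacity in a box is small at a point `x` that is
neither in the box nor in a box next to it: it is at most of the order of the potential of `η` times
the counting measure of the whole box. -/
theorem far_potential_le {d M L n k : ℕ} (hd : 3 ≤ d) (hR : 0 < side M L n k)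
    {x z : Fin d → ℤ} {A : Finset (Fin d → ℤ)} {η : ℝ} (hA : A ⊆ gridBox M L n k z)
    (hcap : capacity A ≤ η * (side M L n k : ℝ) ^ (d - 2))
    (hfar : ¬ ∀ i, |z i - cellIdx M L n k x i| ≤ 1) :
    (side M L n k : ℝ) ^ 2 * ∑ y ∈ A, escapeProb A y * greenFn d (x - y) ≤
      η * cStar d * 2 ^ (d - 2) *
        ∑ y ∈ gridBox M L n k z, ((supNorm (x - y) : ℝ) ^ (d - 2))⁻¹ := by
  set R : ℝ := (side M L n k : ℝ) with hRdef
  set S : ℝ := ∑ y ∈ gridBox M L n k z, ((supNorm (x - y) : ℝ) ^ (d - 2))⁻¹ with hS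
  have hR0 : 0 < R := by rw [hRdef]; exact_mod_cast hR
  have hc := cStar_nonneg hd
  have hS0 : 0 ≤ S := Finset.sum_nonneg fun y _ => by positivity
  have hG : ∀ y ∈ A, R ^ d * greenFn d (x - y) ≤ cStar d * 2 ^ (d - 2) * S := by
    intro y hy
    have hpos := (supNorm_sub_le_two_mul hR (hA hy) (hA hy) hfar).1
    have hpos' : (0 : ℝ) < supNorm (x - y) := by exact_mod_cast hpos
    have hne : x - y ≠ 0 := fun h => hpos.ne' (supNorm_eq_zero.2 h)
    have h1 : R ^ d * ((supNorm (x - y) : ℝ) ^ (d - 2))⁻¹ ≤ 2 ^ (d - 2) * S := by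
      calc R ^ d * ((supNorm (x - y) : ℝ) ^ (d - 2))⁻¹
          = ∑ y' ∈ gridBox M L n k z, ((supNorm (x - y) : ℝ) ^ (d - 2))⁻¹ := by
            rw [Finset.sum_const, card_gridBox, nsmul_eq_mul]
            push_cast
            rfl
        _ ≤ ∑ y' ∈ gridBox M L n k z, 2 ^ (d - 2) * ((supNorm (x - y') : ℝ) ^ (d - 2))⁻¹ := by
            refine Finset.sum_le_sum fun y' hy' => ?_
            have hle : (supNorm (x - y') : ℝ) ≤ 2 * supNorm (x - y) := by
              exact_mod_cast (supNorm_sub_le_two_mul hR (hA hy) hy' hfar).2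
            have hpos'' : (0 : ℝ) < supNorm (x - y') := by
              exact_mod_cast (supNorm_sub_le_two_mul hR hy' hy' hfar).1
            rw [← div_eq_mul_inv, le_div_iff₀ (by positivity), inv_mul_eq_div,
              div_le_iff₀ (by positivity), ← mul_pow]
            exact pow_le_pow_left₀ hpos''.le hle _
        _ = _ := by rw [← Finset.mul_sum]
    calc _ ≤ R ^ d * (cStar d * ((supNorm (x - y) : ℝ) ^ (d - 2))⁻¹) :=
          mul_le_mul_of_nonneg_left (greenFn_le_cStar_div hd hne) (by positivity)
      _ = cStar d * (R ^ d * ((supNorm (x - y) : ℝ) ^ (d - 2))⁻¹) := by ring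
      _ ≤ cStar d * (2 ^ (d - 2) * S) := mul_le_mul_of_nonneg_left h1 hc
      _ = _ := by ring
  have hRd : R ^ d = R ^ (d - 2) * R ^ 2 := by rw [← pow_add]; congr 1; omega
  refine le_of_mul_le_mul_left ?_ (pow_pos hR0 (d - 2))
  calc R ^ (d - 2) * (R ^ 2 * ∑ y ∈ A, escapeProb A y * greenFn d (x - y))
      = ∑ y ∈ A, escapeProb A y * (R ^ d * greenFn d (x - y)) := by
        rw [← mul_assoc, ← hRd, Finset.mul_sum]
        exact Finset.sum_congr rfl fun y _ => by ring
    _ ≤ ∑ y ∈ A, escapeProb A y * (cStar d * 2 ^ (d - 2) * S) :=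
        Finset.sum_le_sum fun y hy => mul_le_mul_of_nonneg_left (hG y hy) (escapeProb_nonneg A y)
    _ = capacity A * (cStar d * 2 ^ (d - 2) * S) := by
        rw [← Finset.sum_mul, ← capacity_eq (by omega)]
    _ ≤ η * R ^ (d - 2) * (cStar d * 2 ^ (d - 2) * S) :=
        mul_le_mul_of_nonneg_right hcap (by positivity)
    _ = _ := by ring

/-- The trace of `F` on the box of depth `ℓ` and index `z` has capacity less than `2 δ` times the
natural scale `R ^ (d - 2)`, where `R` is the side of the box. -/
def HasSmallCapacity {d : ℕ} (M L n : ℕ) (F : Set (Fin d → ℤ)) (ℓ : ℕ) (z : Fin d → ℤ) : Prop :=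
  capacity (interSet (gridBox M L n ℓ z) F) < 2 * delta d M * (side M L n ℓ : ℝ) ^ (d - 2)

/-- The weighted sum of the equilibrium potentials of disjoint boxes of small capacity strictly
inside a box of side `R` is at most `(3 ^ d + 1) (R / M) ^ 2`. The `3 ^ d` boxes of each depth near
`x` contribute at most the square of their side each, since equilibrium potentials are at most `1`;
the contribution of the other boxes is bounded by `far_potential_le` and disjointness. -/
theorem sum_potential_le {d M L n ℓ : ℕ} (hd : 3 ≤ d) (hM : ∃ b : ℕ, M = 2 ^ b) (hM4 : 4 < M)
    (hMd : 3 ^ d + 1 < M ^ 2) (hL : 0 < L) (hℓ : ℓ ≤ n) (F : Set (Fin d → ℤ)) {z : Fin d → ℤ}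
    (C : Finset (ℕ × (Fin d → ℤ)))
    (hC : ∀ p ∈ C, ℓ < p.1 ∧ p.1 ≤ n ∧ gridBox M L n p.1 p.2 ⊆ gridBox M L n ℓ z ∧
      HasSmallCapacity M L n F p.1 p.2)
    (hdisj : (C : Set (ℕ × (Fin d → ℤ))).PairwiseDisjoint fun p => gridBox M L n p.1 p.2)
    {x : Fin d → ℤ} (hx : x ∈ gridBox M L n ℓ z) :
    ∑ p ∈ C, (side M L n p.1 : ℝ) ^ 2 * ∑ y ∈ interSet (gridBox M L n p.1 p.2) F,
        escapeProb (interSet (gridBox M L n p.1 p.2) F) y * greenFn d (x - y) ≤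
      ((3 : ℝ) ^ d + 1) / (M : ℝ) ^ 2 * (side M L n ℓ : ℝ) ^ 2 := by
  classical
  have hM0 : 0 < M := by omega
  set near : ℕ × (Fin d → ℤ) → Prop := fun p => ∀ i, |p.2 i - cellIdx M L n p.1 x i| ≤ 1
    with hnear
  set R : ℝ := (side M L n ℓ : ℝ) with hRdef
  rw [← Finset.sum_filter_add_sum_filter_not C near]
  have h1 : ∑ p ∈ C with near p, (side M L n p.1 : ℝ) ^ 2 *
      ∑ y ∈ interSet (gridBox M L n p.1 p.2) F,
        escapeProb (interSet (gridBox M L n p.1 p.2) F) y * greenFn d (x - y) ≤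
      3 ^ d * R ^ 2 / ((M : ℝ) ^ 2 - 1) := by
    have hM1 : (1 : ℝ) < (M : ℝ) ^ 2 := one_lt_pow₀ (by exact_mod_cast by omega) two_ne_zero
    rw [le_div_iff₀' (by linarith)]
    refine le_trans (mul_le_mul_of_nonneg_left (Finset.sum_le_sum fun p hp => ?_) (by linarith))
      (sum_near_side_sq_le hM0 hℓ x (C.filter near) fun p hp => ?_)
    · exact mul_le_of_le_one_right (by positivity) (sum_escapeProb_mul_greenFn_le_one hd _ x)
    · obtain ⟨hp, hn⟩ := Finset.mem_filter.1 hp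
      exact ⟨(hC p hp).1, (hC p hp).2.1, hn⟩
  have h2 : ∑ p ∈ C with ¬ near p, (side M L n p.1 : ℝ) ^ 2 *
      ∑ y ∈ interSet (gridBox M L n p.1 p.2) F,
        escapeProb (interSet (gridBox M L n p.1 p.2) F) y * greenFn d (x - y) ≤
      (4 * (M : ℝ) ^ (2 * d - 2))⁻¹ * 2 ^ (d - 2) * (d * 3 ^ (d - 1) * R ^ 2) := by
    have hnx : ∀ p ∈ C, ¬ near p → x ∉ gridBox M L n p.1 p.2 := by
      intro p hp hn hxp
      refine hn fun i => ?_
      rw [(mem_gridBox (side_pos hM0 hL)).1 hxp]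
      simp
    have hdisj' : ((C.filter fun p => ¬ near p : Finset _) :
        Set (ℕ × (Fin d → ℤ))).PairwiseDisjoint fun p => gridBox M L n p.1 p.2 :=
      hdisj.subset (Finset.coe_subset.2 (Finset.filter_subset _ _))
    have hsum : ∑ p ∈ C with ¬ near p, ∑ y ∈ gridBox M L n p.1 p.2,
        ((supNorm (x - y) : ℝ) ^ (d - 2))⁻¹ ≤ d * 3 ^ (d - 1) * R ^ 2 := by
      rw [← Finset.sum_biUnion hdisj']
      have h3 := sum_inv_supNorm_pow_le hd (R := side M L n ℓ)
        (S := ((C.filter fun p => ¬ near p).biUnion fun p => gridBox M L n p.1 p.2).image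
          fun y => x - y) ?_
      · rwa [Finset.sum_image fun _ _ _ _ h => sub_right_injective h] at h3
      · intro w hw
        obtain ⟨y, hy, rfl⟩ := Finset.mem_image.1 hw
        obtain ⟨p, hp, hyp⟩ := Finset.mem_biUnion.1 hy
        obtain ⟨hp, hn⟩ := Finset.mem_filter.1 hp
        refine ⟨fun h => hnx p hp hn ?_, supNorm_sub_lt (side_pos hM0 hL) hx ((hC p hp).2.2.1 hyp)⟩
        rwa [sub_eq_zero.1 h]
    calc _ ≤ ∑ p ∈ C with ¬ near p, 2 * delta d M * cStar d * 2 ^ (d - 2) *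
            ∑ y ∈ gridBox M L n p.1 p.2, ((supNorm (x - y) : ℝ) ^ (d - 2))⁻¹ := by
          refine Finset.sum_le_sum fun p hp => ?_
          obtain ⟨hp, hn⟩ := Finset.mem_filter.1 hp
          exact far_potential_le hd (side_pos hM0 hL) (interSet_subset _ _)
            (hC p hp).2.2.2.le hn
      _ = 2 * delta d M * cStar d * 2 ^ (d - 2) * ∑ p ∈ C with ¬ near p,
            ∑ y ∈ gridBox M L n p.1 p.2, ((supNorm (x - y) : ℝ) ^ (d - 2))⁻¹ := by
          rw [← Finset.mul_sum]
      _ ≤ _ := by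
          refine mul_le_mul (mul_le_mul_of_nonneg_right (two_delta_mul_cStar_le hd M)
            (by positivity)) hsum (Finset.sum_nonneg fun p _ => Finset.sum_nonneg fun y _ => ?_)
            (by positivity)
          positivity
  refine (add_le_add h1 h2).trans ?_
  -- with `X = M²`, `T = 3 ^ d` and `κ` the constant of the second sum (up to the factor `X⁻²`), the
  -- claim reads `T / (X - 1) + κ / X² ≤ (T + 1) / X`, and `κ ≤ X - (T + 1)`
  have hnum : (2 : ℝ) ^ (d - 2) * (d * 3 ^ (d - 1)) + 4 * (M : ℝ) ^ (2 * d - 6) * (3 ^ d + 1) ≤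
      4 * (M : ℝ) ^ (2 * d - 6) * (M : ℝ) ^ 2 := by
    exact_mod_cast two_pow_mul_three_pow_le hd hM hM4 hMd
  have hMpow : (M : ℝ) ^ (2 * d - 2) = (M : ℝ) ^ (2 * d - 6) * ((M : ℝ) ^ 2) ^ 2 := by
    rw [← pow_mul, ← pow_add]
    congr 1
    omega
  have hMd' : (3 : ℝ) ^ d + 1 < (M : ℝ) ^ 2 := by exact_mod_cast hMd
  have hQ0 : (0 : ℝ) < (M : ℝ) ^ (2 * d - 6) := pow_pos (by exact_mod_cast hM0) _
  have hT0 : (0 : ℝ) < 3 ^ d := by positivity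
  rw [hMpow]
  have e : (4 * ((M : ℝ) ^ (2 * d - 6) * ((M : ℝ) ^ 2) ^ 2))⁻¹ * 2 ^ (d - 2) *
      (d * 3 ^ (d - 1) * R ^ 2) = ((2 : ℝ) ^ (d - 2) * (d * 3 ^ (d - 1))) /
        (4 * (M : ℝ) ^ (2 * d - 6)) / ((M : ℝ) ^ 2) ^ 2 * R ^ 2 := by
    have : (0 : ℝ) < M := by exact_mod_cast hM0
    field_simp
  rw [e]
  have hk : ((2 : ℝ) ^ (d - 2) * (d * 3 ^ (d - 1))) / (4 * (M : ℝ) ^ (2 * d - 6)) ≤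
      (M : ℝ) ^ 2 - (3 ^ d + 1) := by
    rw [div_le_iff₀ (by positivity)]
    linarith
  generalize ((2 : ℝ) ^ (d - 2) * (d * 3 ^ (d - 1))) / (4 * (M : ℝ) ^ (2 * d - 6)) = κ at hk
  generalize (M : ℝ) ^ 2 = X at *
  generalize (3 : ℝ) ^ d = T at *
  have hX : 0 < X - 1 := by linarith
  have hX' : 0 < X := by linarith
  have h3 : κ / X ^ 2 ≤ (X - (T + 1)) / (X * (X - 1)) := by
    refine div_le_div₀ (by linarith) hk (by positivity) ?_
    nlinarith
  have h4 : T / (X - 1) + (X - (T + 1)) / (X * (X - 1)) = (T + 1) / X := by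
    field_simp
    ring
  calc T * R ^ 2 / (X - 1) + κ / X ^ 2 * R ^ 2 = (T / (X - 1) + κ / X ^ 2) * R ^ 2 := by ring
    _ ≤ (T + 1) / X * R ^ 2 := mul_le_mul_of_nonneg_right (by linarith) (sq_nonneg R)

/-! ### Counting points by their number of boxes of small capacity -/

/-- The ratio by which the weight `R ^ 2 cap(B ∩ F)` decreases from a box to the boxes of small
capacity inside it. -/
noncomputable def ratio (d M : ℕ) : ℝ := ((3 : ℝ) ^ d + 1) / (M : ℝ) ^ 2

/-- The weights `R ^ 2 cap(B ∩ F)` of disjoint boxes of small capacity strictly inside a box sum up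
to at most `ratio d M` times the weight of this box. -/
theorem sum_weight_le {d M L n ℓ : ℕ} (hd : 3 ≤ d) (hM : ∃ b : ℕ, M = 2 ^ b) (hM4 : 4 < M)
    (hMd : 3 ^ d + 1 < M ^ 2) (hL : 0 < L) (hℓ : ℓ ≤ n) (F : Set (Fin d → ℤ)) {z : Fin d → ℤ}
    (C : Finset (ℕ × (Fin d → ℤ)))
    (hC : ∀ p ∈ C, ℓ < p.1 ∧ p.1 ≤ n ∧ gridBox M L n p.1 p.2 ⊆ gridBox M L n ℓ z ∧
      HasSmallCapacity M L n F p.1 p.2)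
    (hdisj : (C : Set (ℕ × (Fin d → ℤ))).PairwiseDisjoint fun p => gridBox M L n p.1 p.2) :
    ∑ p ∈ C, (side M L n p.1 : ℝ) ^ 2 * capacity (interSet (gridBox M L n p.1 p.2) F) ≤
      ratio d M * ((side M L n ℓ : ℝ) ^ 2 * capacity (interSet (gridBox M L n ℓ z) F)) := by
  rw [← mul_assoc]
  refine sum_mul_capacity_le hd C _ _ (fun p hp x hx => ?_) fun x hx =>
    sum_potential_le hd hM hM4 hMd hL hℓ F C hC hdisj (interSet_subset _ _ hx)
  rw [mem_interSet] at hx ⊢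
  exact ⟨(hC p hp).2.2.1 hx.1, hx.2⟩

open Classical in
/-- The depths in `(ℓ, q]` at which the box containing `x` has small capacity. -/
noncomputable def smallDepths {d : ℕ} (M L n : ℕ) (F : Set (Fin d → ℤ)) (q ℓ : ℕ)
    (x : Fin d → ℤ) : Finset ℕ :=
  {k ∈ Finset.Ioc ℓ q | HasSmallCapacity M L n F k (cellIdx M L n k x)}

/-- The points of `F` in a box of depth `ℓ` that lie in at least `m` boxes of small capacity of
depth in `(ℓ, q]`. -/
noncomputable def manySmall {d : ℕ} (M L n : ℕ) (F : Set (Fin d → ℤ)) (q m ℓ : ℕ)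
    (z : Fin d → ℤ) : Finset (Fin d → ℤ) :=
  {x ∈ interSet (gridBox M L n ℓ z) F | m ≤ (smallDepths M L n F q ℓ x).card}

theorem mem_smallDepths {d M L n : ℕ} {F : Set (Fin d → ℤ)} {q ℓ k : ℕ} {x : Fin d → ℤ} :
    k ∈ smallDepths M L n F q ℓ x ↔
      (ℓ < k ∧ k ≤ q) ∧ HasSmallCapacity M L n F k (cellIdx M L n k x) := by
  classical
  rw [smallDepths, Finset.mem_filter, Finset.mem_Ioc]

/-- The maximal boxes of small capacity strictly inside a box cover the points that lie in some
box of small capacity; passing to such a maximal box uses up exactly one small depth. -/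
theorem exists_maximal_boxes {d M L n q ℓ : ℕ} (hM : 0 < M) (hL : 0 < L) (hqn : q ≤ n)
    (F : Set (Fin d → ℤ)) (m : ℕ) (z : Fin d → ℤ) :
    ∃ C : Finset (ℕ × (Fin d → ℤ)),
      (∀ p ∈ C, ℓ < p.1 ∧ p.1 ≤ q ∧ gridBox M L n p.1 p.2 ⊆ gridBox M L n ℓ z ∧
        HasSmallCapacity M L n F p.1 p.2) ∧
      (C : Set (ℕ × (Fin d → ℤ))).PairwiseDisjoint (fun p => gridBox M L n p.1 p.2) ∧
      (manySmall M L n F q (m + 1) ℓ z).card ≤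
        ∑ p ∈ C, (manySmall M L n F q m p.1 p.2).card := by
  classical
  have hR : ∀ k, 0 < side M L n k := fun k => side_pos hM hL
  obtain ⟨first, hmem, hle⟩ : ∃ first : (Fin d → ℤ) → ℕ,
      (∀ x ∈ manySmall M L n F q (m + 1) ℓ z, first x ∈ smallDepths M L n F q ℓ x) ∧
      ∀ x k, k ∈ smallDepths M L n F q ℓ x → first x ≤ k := by
    refine ⟨fun x => sInf (smallDepths M L n F q ℓ x : Set ℕ), fun x hx => ?_,
      fun x k hk => Nat.sInf_le hk⟩
    have hcard := (Finset.mem_filter.1 hx).2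
    exact Nat.sInf_mem (Finset.coe_nonempty.2 (Finset.card_pos.1 (by omega)))
  refine ⟨(manySmall M L n F q (m + 1) ℓ z).image
    fun x => (first x, cellIdx M L n (first x) x), ?_, ?_, ?_⟩
  · intro p hp
    obtain ⟨x, hx, rfl⟩ := Finset.mem_image.1 hp
    obtain ⟨⟨h1, h2⟩, h3⟩ := mem_smallDepths.1 (hmem x hx)
    refine ⟨h1, h2, fun y hy => ?_, h3⟩
    have hxz := (mem_interSet.1 (Finset.mem_filter.1 hx).1).1
    rw [mem_gridBox (hR _)] at hy hxz ⊢
    rw [← hxz]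
    exact cellIdx_eq_of_le h1.le (h2.trans hqn) hy
  · -- the larger of two intersecting boxes contains both points, so its depth is a small depth of
    -- the second one as well
    have key : ∀ x ∈ manySmall M L n F q (m + 1) ℓ z, ∀ x' ∈ manySmall M L n F q (m + 1) ℓ z,
        ∀ y, y ∈ gridBox M L n (first x) (cellIdx M L n (first x) x) →
          y ∈ gridBox M L n (first x') (cellIdx M L n (first x') x') →
          first x ≤ first x' → first x = first x' := by
      intro x hx x' hx' y hy hy' hlt
      obtain ⟨⟨h1, h2⟩, h3⟩ := mem_smallDepths.1 (hmem x hx)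
      obtain ⟨⟨h1', h2'⟩, h3'⟩ := mem_smallDepths.1 (hmem x' hx')
      rw [mem_gridBox (hR _)] at hy hy'
      have he := cellIdx_eq_of_le hlt (h2'.trans hqn) hy'
      refine le_antisymm hlt (hle x' _ (mem_smallDepths.2 ⟨⟨h1, h2⟩, ?_⟩))
      exact (he.symm.trans hy) ▸ h3
    intro p hp p' hp' hne'
    obtain ⟨x, hx, rfl⟩ := Finset.mem_image.1 (Finset.mem_coe.1 hp)
    obtain ⟨x', hx', rfl⟩ := Finset.mem_image.1 (Finset.mem_coe.1 hp')
    refine Finset.disjoint_left.2 fun y hy hy' => hne' ?_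
    have heq : first x = first x' := by
      rcases le_total (first x) (first x') with h | h
      · exact key x hx x' hx' y hy hy' h
      · exact (key x' hx' x hx y hy' hy h).symm
    simp only [mem_gridBox (hR _)] at hy hy'
    rw [Prod.mk.injEq]
    refine ⟨heq, ?_⟩
    rw [← hy, ← hy', heq]
  · refine le_trans (Finset.card_le_card fun x hx => ?_) Finset.card_biUnion_le
    refine Finset.mem_biUnion.2 ⟨_, Finset.mem_image_of_mem _ hx, ?_⟩
    obtain ⟨hxF, hcard⟩ := Finset.mem_filter.1 hx
    refine Finset.mem_filter.2
      ⟨mem_interSet.2 ⟨mem_gridBox_cellIdx (hR _) x, (mem_interSet.1 hxF).2⟩, ?_⟩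
    have hsub : smallDepths M L n F q ℓ x ⊆
        insert (first x) (smallDepths M L n F q (first x) x) := by
      intro k hk
      rcases (hle x k hk).eq_or_lt with h | h
      · exact Finset.mem_insert.2 (Or.inl h.symm)
      · obtain ⟨⟨-, h2⟩, h3⟩ := mem_smallDepths.1 hk
        exact Finset.mem_insert_of_mem (mem_smallDepths.2 ⟨⟨h, h2⟩, h3⟩)
    have := (Finset.card_le_card hsub).trans (Finset.card_insert_le _ _)
    dsimp only
    omega

/-- A multiple of `R ^ 2` bounding the Green potential of a box of side `R`. -/
noncomputable def boxConst (d : ℕ) : ℝ := greenFn d 0 + cStar d * (d * 3 ^ (d - 1))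

theorem boxConst_nonneg {d : ℕ} (hd : 3 ≤ d) : 0 ≤ boxConst d := by
  have := cStar_nonneg hd
  have := greenFn_nonneg d 0
  unfold boxConst
  positivity

theorem ratio_pos {d M : ℕ} (hM : 0 < M) : 0 < ratio d M := by
  unfold ratio; positivity

theorem card_manySmall_le_weight {d M L n q : ℕ} (hd : 3 ≤ d) (hM : ∃ b : ℕ, M = 2 ^ b)
    (hM4 : 4 < M) (hMd : 3 ^ d + 1 < M ^ 2) (hL : 0 < L) (hqn : q ≤ n) (F : Set (Fin d → ℤ))
    (m ℓ : ℕ) (hℓ : ℓ ≤ q) (z : Fin d → ℤ) :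
    ((manySmall M L n F q m ℓ z).card : ℝ) ≤ boxConst d * ratio d M ^ m *
      ((side M L n ℓ : ℝ) ^ 2 * capacity (interSet (gridBox M L n ℓ z) F)) := by
  have hM0 : 0 < M := by omega
  induction m generalizing ℓ z with
  | zero =>
    have h1 : (manySmall M L n F q 0 ℓ z).card ≤ (interSet (gridBox M L n ℓ z) F).card :=
      Finset.card_filter_le _ _
    rw [pow_zero, mul_one]
    exact (Nat.cast_le.2 h1).trans
      (card_le_capacity hd (side_pos hM0 hL) (interSet_subset _ _))
  | succ m ih =>
    obtain ⟨C, hC, hdisj, hcard⟩ := exists_maximal_boxes (ℓ := ℓ) hM0 hL hqn F m z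
    have h0 : 0 ≤ boxConst d * ratio d M ^ m :=
      mul_nonneg (boxConst_nonneg hd) (pow_nonneg (ratio_pos hM0).le _)
    calc ((manySmall M L n F q (m + 1) ℓ z).card : ℝ)
        ≤ ∑ p ∈ C, ((manySmall M L n F q m p.1 p.2).card : ℝ) := by exact_mod_cast hcard
      _ ≤ ∑ p ∈ C, boxConst d * ratio d M ^ m *
          ((side M L n p.1 : ℝ) ^ 2 * capacity (interSet (gridBox M L n p.1 p.2) F)) :=
          Finset.sum_le_sum fun p hp => ih p.1 (hC p hp).2.1 p.2
      _ = boxConst d * ratio d M ^ m * ∑ p ∈ C,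
          ((side M L n p.1 : ℝ) ^ 2 * capacity (interSet (gridBox M L n p.1 p.2) F)) := by
          rw [← Finset.mul_sum]
      _ ≤ boxConst d * ratio d M ^ m * (ratio d M *
          ((side M L n ℓ : ℝ) ^ 2 * capacity (interSet (gridBox M L n ℓ z) F))) := by
          refine mul_le_mul_of_nonneg_left ?_ h0
          exact sum_weight_le hd hM hM4 hMd hL (hℓ.trans hqn) F C
            (fun p hp => ⟨(hC p hp).1, (hC p hp).2.1.trans hqn, (hC p hp).2.2⟩) hdisj
      _ = _ := by rw [pow_succ]; ring

/-- Relative to the volume of the box one small depth is lost, as the box itself need not have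
small capacity. -/
theorem card_manySmall_le_card {d M L n q : ℕ} (hd : 3 ≤ d) (hM : ∃ b : ℕ, M = 2 ^ b)
    (hM4 : 4 < M) (hMd : 3 ^ d + 1 < M ^ 2) (hL : 0 < L) (hqn : q ≤ n) (F : Set (Fin d → ℤ))
    (m ℓ : ℕ) (z : Fin d → ℤ) :
    ((manySmall M L n F q (m + 1) ℓ z).card : ℝ) ≤
      boxConst d * ratio d M ^ m * (2 * delta d M * (gridBox M L n ℓ z).card) := by
  classical
  have hM0 : 0 < M := by omega
  have h0 : 0 ≤ boxConst d * ratio d M ^ m :=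
    mul_nonneg (boxConst_nonneg hd) (pow_nonneg (ratio_pos hM0).le _)
  have hδ := delta_nonneg hd M
  obtain ⟨C, hC, hdisj, hcard⟩ := exists_maximal_boxes (ℓ := ℓ) hM0 hL hqn F m z
  have hvol : ∑ p ∈ C, ((gridBox M L n p.1 p.2).card : ℝ) ≤ (gridBox M L n ℓ z).card := by
    rw [← Nat.cast_sum, ← Finset.card_biUnion hdisj]
    exact_mod_cast Finset.card_le_card (Finset.biUnion_subset.2 fun p hp => (hC p hp).2.2.1)
  calc ((manySmall M L n F q (m + 1) ℓ z).card : ℝ)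
      ≤ ∑ p ∈ C, ((manySmall M L n F q m p.1 p.2).card : ℝ) := by exact_mod_cast hcard
    _ ≤ ∑ p ∈ C, boxConst d * ratio d M ^ m *
        (2 * delta d M * ((gridBox M L n p.1 p.2).card : ℝ)) := by
        refine Finset.sum_le_sum fun p hp => ?_
        refine (card_manySmall_le_weight hd hM hM4 hMd hL hqn F m p.1 (hC p hp).2.1 p.2).trans
          (mul_le_mul_of_nonneg_left ?_ h0)
        have h1 : capacity (interSet (gridBox M L n p.1 p.2) F) ≤
            2 * delta d M * (side M L n p.1 : ℝ) ^ (d - 2) := (hC p hp).2.2.2.le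
        have h2 : (side M L n p.1 : ℝ) ^ d =
            (side M L n p.1 : ℝ) ^ 2 * (side M L n p.1 : ℝ) ^ (d - 2) := by
          rw [← pow_add]; congr 1; omega
        rw [card_gridBox, Nat.cast_pow, h2]
        calc _ ≤ (side M L n p.1 : ℝ) ^ 2 *
              (2 * delta d M * (side M L n p.1 : ℝ) ^ (d - 2)) :=
              mul_le_mul_of_nonneg_left h1 (by positivity)
          _ = _ := by ring
    _ = boxConst d * ratio d M ^ m * (2 * delta d M *
        ∑ p ∈ C, ((gridBox M L n p.1 p.2).card : ℝ)) := by
        simp only [← Finset.mul_sum]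
    _ ≤ _ := mul_le_mul_of_nonneg_left (mul_le_mul_of_nonneg_left hvol (by positivity)) h0

/-! ### Rarefied boxes -/

theorem card_rpow_eq {d M L n ℓ : ℕ} (hd : 3 ≤ d) (z : Fin d → ℤ) :
    ((gridBox M L n ℓ z).card : ℝ) ^ (((d : ℝ) - 2) / (d : ℝ)) =
      (side M L n ℓ : ℝ) ^ (d - 2) := by
  have hd' : (d : ℝ) ≠ 0 := by exact_mod_cast (by omega : d ≠ 0)
  rw [card_gridBox, Nat.cast_pow, ← Real.rpow_natCast, ← Real.rpow_mul (by positivity),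
    ← Real.rpow_natCast]
  congr 1
  rw [Nat.cast_sub (by omega)]
  push_cast
  field_simp

/-- A rarefied box of depth `q` lies in more than `q / 2` boxes of small capacity, by Markov's
inequality for the average over the tower. -/
theorem lt_two_mul_card_smallDepths {d M L n q : ℕ} (hd : 3 ≤ d) (hM4 : 4 < M) (hL : 0 < L)
    (hq : 1 ≤ q) (hqn : q ≤ n) (F : Set (Fin d → ℤ)) {x : Fin d → ℤ}
    (hB : IsRarefied M L n q F (gridBox M L n q (cellIdx M L n q x))) :
    q < 2 * (smallDepths M L n F q 0 x).card := by
  classical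
  have hM0 : 0 < M := by omega
  have hR : ∀ k, 0 < side M L n k := fun k => side_pos hM0 hL
  have hδ := delta_nonneg hd M
  set B := gridBox M L n q (cellIdx M L n q x) with hBdef
  set b : ℕ → Finset (Fin d → ℤ) := fun k => gridBox M L n k (cellIdx M L n k x) with hb
  have hnest : ∀ k k', k ≤ k' → k' ≤ n → b k' ⊆ b k := by
    intro k k' h hn y hy
    rw [hb, mem_gridBox (hR _)] at hy ⊢
    exact cellIdx_eq_of_le h hn hy
  have hadic : ∀ k, b k ∈ adicBoxes d M L n k := fun k => by
    rw [adicBoxes_eq]; exact ⟨_, rfl⟩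
  have hanc : ancestor M L n 1 B = b 1 := by
    have h1 := ancestor_spec hM0 hL hq hqn (hadic q)
    exact (existsUnique_ancestor hM0 hL hq hqn (hadic q)).unique h1
      ⟨hadic 1, hnest 1 q hq hqn⟩
  set term : ℕ → ℝ := fun k =>
    capacity (interSet (b k) F) / (side M L n k : ℝ) ^ (d - 2) with hterm
  have hterm0 : ∀ k, 0 ≤ term k := fun k => div_nonneg (capacity_nonneg _) (by positivity)
  have hinj : Set.InjOn b (Finset.Ioc 0 q : Set ℕ) := by
    have hlt : ∀ k k', k < k' → k' ≤ n → (b k').card < (b k).card := by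
      intro k k' h hn
      simp only [hb, card_gridBox]
      refine Nat.pow_lt_pow_left ?_ (by omega)
      rw [side_eq_mul h.le hn]
      exact lt_mul_of_one_lt_left (hR k') (Nat.one_lt_pow (by omega) (by omega))
    intro k hk k' hk' h
    have h1 := (Finset.mem_Ioc.1 (Finset.mem_coe.1 hk)).2.trans hqn
    have h2 := (Finset.mem_Ioc.1 (Finset.mem_coe.1 hk')).2.trans hqn
    rcases lt_trichotomy k k' with hlt' | heq | hlt'
    · exact absurd (congrArg Finset.card h) (hlt k k' hlt' h2).ne'
    · exact heq
    · exact absurd (congrArg Finset.card h) (hlt k' k hlt' h1).ne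
  have hsum : ∑ k ∈ Finset.Ioc 0 q, term k < delta d M * q := by
    refine lt_of_le_of_lt ?_ hB
    rw [hanc]
    have h1 : ∑ k ∈ Finset.Ioc 0 q, term k = ∑ B' ∈ (Finset.Ioc 0 q).image b,
        capacity (interSet B' F) / (B'.card : ℝ) ^ (((d : ℝ) - 2) / (d : ℝ)) := by
      rw [Finset.sum_image hinj]
      exact Finset.sum_congr rfl fun k _ => by rw [card_rpow_eq hd]
    rw [h1]
    refine Finset.sum_le_sum_of_subset_of_nonneg (fun B' hB' => ?_) fun B' _ _ =>
      div_nonneg (capacity_nonneg _) (by positivity)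
    obtain ⟨k, hk, rfl⟩ := Finset.mem_image.1 hB'
    obtain ⟨hk0, hkq⟩ := Finset.mem_Ioc.1 hk
    exact Finset.mem_filter.2 ⟨Finset.mem_powerset.2 (hnest 1 k hk0 (hkq.trans hqn)),
      k, hkq, hadic k, hnest k q hkq hqn⟩
  have hsub : smallDepths M L n F q 0 x ⊆ Finset.Ioc 0 q := fun k hk =>
    Finset.mem_Ioc.2 (mem_smallDepths.1 hk).1
  have hlow : ((Finset.Ioc 0 q \ smallDepths M L n F q 0 x).card : ℝ) * (2 * delta d M) ≤
      ∑ k ∈ Finset.Ioc 0 q, term k := by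
    rw [← nsmul_eq_mul]
    refine (Finset.card_nsmul_le_sum _ term _ fun k hk => ?_).trans
      (Finset.sum_le_sum_of_subset_of_nonneg Finset.sdiff_subset fun k _ _ => hterm0 k)
    obtain ⟨hk1, hk2⟩ := Finset.mem_sdiff.1 hk
    have h3 : ¬ HasSmallCapacity M L n F k (cellIdx M L n k x) := fun h =>
      hk2 (mem_smallDepths.2 ⟨Finset.mem_Ioc.1 hk1, h⟩)
    have hRk : (0 : ℝ) < (side M L n k : ℝ) ^ (d - 2) := pow_pos (by exact_mod_cast hR k) _
    rw [hterm, le_div_iff₀ hRk]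
    exact not_lt.1 h3
  have hcard := Finset.card_sdiff_add_card_eq_card hsub
  rw [Nat.card_Ioc, Nat.sub_zero] at hcard
  by_contra hcon
  push Not at hcon
  have h5 : (q : ℝ) ≤ 2 * ((Finset.Ioc 0 q \ smallDepths M L n F q 0 x).card : ℝ) := by
    exact_mod_cast (by omega)
  nlinarith

/-- The rarefied boxes are disjoint, and their points in `F` have more than `q / 2` small depths. -/
theorem sum_rarefied_card_le {d M L n q : ℕ} (hd : 3 ≤ d) (hM4 : 4 < M) (hL : 0 < L)
    (hq : 1 ≤ q) (hqn : q ≤ n) (F : Set (Fin d → ℤ)) (z : Fin d → ℤ) :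
    ∑ B ∈ rarefiedBoxes M L n q F (gridBox M L n 0 z), (interSet B F).card ≤
      (manySmall M L n F q (q / 2 + 1) 0 z).card := by
  classical
  have hM0 : 0 < M := by omega
  have hR : ∀ k, 0 < side M L n k := fun k => side_pos hM0 hL
  have hB : ∀ B ∈ rarefiedBoxes M L n q F (gridBox M L n 0 z),
      B ⊆ gridBox M L n 0 z ∧ B ∈ adicBoxes d M L n q ∧ IsRarefied M L n q F B := by
    intro B hB
    obtain ⟨h1, h2⟩ := Finset.mem_filter.1 hB
    exact ⟨Finset.mem_powerset.1 h1, h2⟩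
  have hcell : ∀ B ∈ rarefiedBoxes M L n q F (gridBox M L n 0 z), ∀ x ∈ B,
      B = gridBox M L n q (cellIdx M L n q x) := by
    intro B hB' x hx
    obtain ⟨w, rfl⟩ := adicBoxes_eq ▸ (hB B hB').2.1
    rw [(mem_gridBox (hR q)).1 hx]
  rw [← Finset.card_biUnion]
  · refine Finset.card_le_card fun x hx => ?_
    obtain ⟨B, hB', hxB⟩ := Finset.mem_biUnion.1 hx
    rw [mem_interSet] at hxB
    have hrar := (hB B hB').2.2
    rw [hcell B hB' x hxB.1] at hrar
    have := lt_two_mul_card_smallDepths hd hM4 hL hq hqn F hrar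
    exact Finset.mem_filter.2 ⟨mem_interSet.2 ⟨(hB B hB').1 hxB.1, hxB.2⟩, by omega⟩
  · intro B hB1 B' hB2 hne
    refine Finset.disjoint_left.2 fun x hx hx' => hne ?_
    rw [hcell B hB1 x (mem_interSet.1 hx).1, hcell B' hB2 x (mem_interSet.1 hx').1]

end RarefiedBox

theorem proposition2p1 (d : ℕ) (hd : 3 ≤ d) (M : ℕ) (hM : ∃ b : ℕ, M = 2 ^ b) (hM4 : 4 < M)
    (hMd : 3 ^ d + 1 < M ^ 2) :
    ∃ c₃ : ℝ, 0 < c₃ ∧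
      ∀ N ℓN : ℕ, 1 ≤ N →
        M ^ ℓN * scaleL₁ d N ≤ N → N < M ^ (ℓN + 1) * scaleL₁ d N →
        2 * cStar d * (M : ℝ) ^ d < (scaleL₁ d N : ℝ) ^ (d - 2) * green (0 : Fin d → ℤ) 0 →
        ∀ q : ℕ, 1 ≤ q → q ≤ ℓN →
        ∀ F : Set (Fin d → ℤ), ∀ Δ ∈ adicBoxes d M (scaleL₁ d N) ℓN 0,
          ∑ B ∈ rarefiedBoxes M (scaleL₁ d N) ℓN q F Δ, ((interSet B F).card : ℝ) ≤
            c₃ * (Δ.card : ℝ) * ((M : ℝ) ^ 2 / ((3 : ℝ) ^ d + 1)) ^ (-(q : ℝ) / 2) := by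
  have hM0 : 0 < M := by omega
  have hρ : 0 < ratio d M := ratio_pos hM0
  have hδ := delta_nonneg hd M
  have hK := boxConst_nonneg hd
  -- the summand `1` only serves to make the constant positive
  refine ⟨boxConst d * (2 * delta d M) * (ratio d M)⁻¹ + 1, by positivity, ?_⟩
  intro N ℓN _ _ hN _ q hq hqn F Δ hΔ
  have hL : 0 < scaleL₁ d N := Nat.pos_of_ne_zero fun h => by simp [h] at hN
  obtain ⟨z, rfl⟩ := adicBoxes_eq ▸ hΔ
  generalize scaleL₁ d N = L at *
  have h1 : ∑ B ∈ rarefiedBoxes M L ℓN q F (gridBox M L ℓN 0 z), ((interSet B F).card : ℝ) ≤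
      (manySmall M L ℓN F q (q / 2 + 1) 0 z).card := by
    exact_mod_cast sum_rarefied_card_le hd hM4 hL hq hqn F z
  have h2 := card_manySmall_le_card hd hM hM4 hMd hL hqn F (q / 2) 0 z
  have hρ1 : ratio d M ≤ 1 := by
    rw [ratio, div_le_one (by positivity)]
    exact_mod_cast hMd.le
  -- the factor `(ratio d M)⁻¹` absorbs the rounding of `q / 2`
  have h3 : ratio d M ^ (q / 2) ≤ (ratio d M)⁻¹ * ratio d M ^ ((q : ℝ) / 2) := by
    rw [← Real.rpow_natCast, ← Real.rpow_neg_one, ← Real.rpow_add hρ]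
    refine Real.rpow_le_rpow_of_exponent_ge hρ hρ1 ?_
    have : (q : ℝ) ≤ 2 * ((q / 2 : ℕ) : ℝ) + 1 := by exact_mod_cast (by omega)
    linarith
  have h4 : ((M : ℝ) ^ 2 / ((3 : ℝ) ^ d + 1)) ^ (-(q : ℝ) / 2) = ratio d M ^ ((q : ℝ) / 2) := by
    rw [neg_div, Real.rpow_neg (by positivity), ← Real.inv_rpow (by positivity), inv_div, ratio]
  rw [h4]
  have hp : 0 ≤ ratio d M ^ ((q : ℝ) / 2) := by positivity
  have hc : (0 : ℝ) ≤ (gridBox M L ℓN 0 z).card := Nat.cast_nonneg _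
  calc _ ≤ _ := h1.trans h2
    _ ≤ boxConst d * ((ratio d M)⁻¹ * ratio d M ^ ((q : ℝ) / 2)) *
        (2 * delta d M * (gridBox M L ℓN 0 z).card) := by gcongr
    _ = boxConst d * (2 * delta d M) * (ratio d M)⁻¹ * (gridBox M L ℓN 0 z).card *
        ratio d M ^ ((q : ℝ) / 2) := by ring
    _ ≤ _ := by
        gcongr
        linarith
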